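/- Let $M$ be a continuous-time irreducible Markov chain on a finite set $V$ with transition rate matrix $Q=(q_{ij})$ such that $q_{ij}>0$ if and only if $q_{ji}>0$. Let $\bar\pi$ be its stationary distribution and $$\bar e_p=\frac12\sum_{i,j}[\bar\pi_iq_{ij}-\bar\pi_jq_{ji}]\log\frac{\bar\pi_iq_{ij}}{\bar\pi_jq_{ji}}$$ its stationary entropy production rate (pairs with $q_{ij}=q_{ji}=0$ and the diagonal contribute $0$). Let $G$ be the simple graph on $V$ whose edges are the pairs of distinct states $i,j$ with $q_{ij}>0$. Choose a spanning tree of $G$, and enumerate and orient the remaining edges $e_1,\dots,e_n$ (so $n=|E|-|V|+1$ is the first Betti number). The lifted chain $L$ has state space $V\times\mathbb{Z}^n$; write $i_\alpha=(i,\alpha)$. For each edge $\{i,j\}$ of $G$ it jumps from $i_\alpha$ to $j_\beta$ with rate $q_{ij}$, where $\beta=\alpha$ if the edge is in the tree, and $\beta=\alpha\pm$ the $k$-th unit vector if the edge is $e_k$, with sign $+$ or $-$ according to whether $e_k$ is traversed along or against its orientation; there are no other jumps. A global potential of $L$ is a function $\varphi$ on $V\times\mathbb{Z}^n$ with $\varphi_{j_\beta}-\varphi_{i_\alpha}=\log(q_{ji}/q_{ij})$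 for adjacent $i_\alpha,j_\beta$. Let $p(t)$, $t\ge0$, be the probability distributions of $L$ at time $t$, i.e. probability distributions solving the forward equation $$\frac{\mathrm d p_{i_\alpha}}{\mathrm dt}=\sum_{j_\beta\sim i_\alpha}\big[p_{j_\beta}q_{ji}-p_{i_\alpha}q_{ij}\big],\qquad t\ge 0.$$ Write $E(t)=\sum p_{i_\alpha}(t)\varphi_{i_\alpha}$ for the mean potential energy, $\mathrm H(t)=-\sum p_{i_\alpha}(t)\log p_{i_\alpha}(t)$ for the entropy and, with $\mu_{i_\alpha}=e^{-\varphi_{i_\alpha}}$, $F^\mu(t)=\sum p_{i_\alpha}(t)\log\big(p_{i_\alpha}(t)/\mu_{i_\alpha}\big)$ for the free energy. Then: 1. $L$ has a global potential, and for every global potential $\varphi$ the measure $\mu=e^{-\varphi}$ is detailed balanced: $\mu_{i_\alpha}q_{ij}=\mu_{j_\beta}q_{ji}$ for adjacent $i_\alpha,j_\beta$. 2. If the sum defining $E(0)$ converges absolutely, then so does the sum defining $E(t)$ for all $t\ge0$, $E$ is differentiable on $(0,\infty)$, and $$\frac{\mathrm dE(t)}{\mathrm dt}\to-\bar e_p\qquad(t\to\infty).$$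 3. There is a constant $C$, depending only on the chain and its lift, such that whenever $\mathrm H(0)<\infty$ one has $\mathrm H(t)<\infty$ for all $t\ge 0$, and $\mathrm H(t)\le \mathrm H(0)+C\log t$ for all $t\ge2$; in particular $\mathrm H(t)/t\to0$. 4. If the sum defining $E(0)$ converges absolutely and $\mathrm H(0)<\infty$, then for all $t\ge 0$ the sum defining $F^\mu(t)$ converges absolutely and $F^\mu(t)=E(t)-\mathrm H(t)$. Moreover $E(t)/t\to-\bar e_p$ and $F^\mu(t)/t\to-\bar e_p$ as $t\to\infty$: the entropy production rate of $M$ is the long-time rate of potential energy (and free energy) dissipation of $L$. -/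

import Mathlib

open Filter Topology

noncomputable section

namespace LiftedChain

/-! ### Continuous-time chains on a countable state space, given by their jump rates -/

section General

variable {S : Type*}

/-- `μ` is detailed balanced for the jump rates `r` (`r x y` is the rate of jumping from `x`
to `y`). -/
def IsDetailedBalanced (r : S → S → ℝ) (μ : S → ℝ) : Prop :=
  ∀ x y, μ x * r x y = μ y * r y x

/-- A global potential: along every possible jump `x → y` its increment is
`log (r y x / r x y)`. -/
def IsGlobalPotential (r : S → S → ℝ) (φ : S → ℝ) : Prop :=
  ∀ x y, 0 < r x y → φ y - φ x = Real.log (r y x / r x y)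

/-- The Gibbs measure `exp (-φ)` (in general not normalizable). -/
def gibbs (φ : S → ℝ) (x : S) : ℝ := Real.exp (-φ x)

/-- `p t`, `t ≥ 0`, is the family of one-time distributions of the chain with rates `r`:
probability distributions solving the Kolmogorov forward (master) equation
`d p_x / dt = ∑_y (p_y r_{yx} - p_x r_{xy})` on `[0, ∞)` (with the one-sided derivative at `0`).
For uniformly bounded rates with finitely many jumps in and out of each state it is determined by
`p 0`. -/
structure IsDistributionFlow (r : S → S → ℝ) (p : ℝ → S → ℝ) : Prop where
  nonneg : ∀ t, 0 ≤ t → ∀ x, 0 ≤ p t x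
  hasSum_one : ∀ t, 0 ≤ t → HasSum (p t) 1
  forward_equation : ∀ t, 0 ≤ t → ∀ x,
    HasDerivWithinAt (fun s => p s x) (∑' y, (p t y * r y x - p t x * r x y)) (Set.Ici 0) t

/-- The distribution `w` has finite entropy. -/
def HasFiniteEntropy (w : S → ℝ) : Prop := Summable fun x => -(w x * Real.log (w x))

/-- The entropy `-∑ w log w`. -/
def entropy (w : S → ℝ) : ℝ := ∑' x, -(w x * Real.log (w x))

/-- The mean potential energy of the distribution `w` is finite. -/
def HasFiniteEnergy (φ w : S → ℝ) : Prop := Summable fun x => w x * φ x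

/-- The mean potential energy `∑ w φ`. -/
def meanEnergy (φ w : S → ℝ) : ℝ := ∑' x, w x * φ x

/-- The free energy (relative entropy) `∑ w log (w / θ)` with respect to a measure `θ`. -/
def freeEnergy (θ w : S → ℝ) : ℝ := ∑' x, w x * Real.log (w x / θ x)

end General

/-! ### The finite chain -/

section Finite

variable {V : Type*}

/-- The graph of the chain: edges are the possible transitions between distinct states. -/
def transitionGraph (Q : Matrix V V ℝ) : SimpleGraph V :=
  SimpleGraph.fromRel fun i j => 0 < Q i j

/-- `Q` is the transition rate matrix of an irreducible finite chain in which a transition is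
possible if and only if the reverse transition is. Under `pos_symm`, irreducibility is
connectedness of the transition graph. -/
structure IsChain [Fintype V] (Q : Matrix V V ℝ) : Prop where
  nonneg_offDiag : ∀ i j, i ≠ j → 0 ≤ Q i j
  row_sum : ∀ i, ∑ j, Q i j = 0
  pos_symm : ∀ i j, 0 < Q i j ↔ 0 < Q j i
  irreducible : (transitionGraph Q).Connected

/-- `w` is a stationary probability distribution of `Q`. -/
structure IsStationary [Fintype V] (Q : Matrix V V ℝ) (w : V → ℝ) : Prop where
  nonneg : ∀ i, 0 ≤ w i
  sum_eq_one : ∑ i, w i = 1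
  stationary : ∀ j, ∑ i, w i * Q i j = 0

/-- The entropy production rate of the finite chain in the distribution `w`. Pairs with no
transition between them contribute `0`, and so does the diagonal. -/
def entropyProduction [Fintype V] (Q : Matrix V V ℝ) (w : V → ℝ) : ℝ :=
  (1 / 2) * ∑ i, ∑ j, (w i * Q i j - w j * Q j i) *
    Real.log ((w i * Q i j) / (w j * Q j i))

/-! ### The lift -/

/-- The data from which the lift is built: a spanning tree of `G`, and an enumeration of the
edges outside the tree, each once and with an orientation. Necessarily `n` is the first Betti
number `|E| - |V| + 1`; crossing the `k`-th edge from `tail k` to `head k` means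
crossing the `k`-th pair of opposite faces of the unit cube. -/
structure TorusEmbedding (G : SimpleGraph V) (n : ℕ) where
  tree : SimpleGraph V
  tree_le : tree ≤ G
  isTree : tree.IsTree
  tail : Fin n → V
  head : Fin n → V
  bijOn : Set.BijOn (fun k => s(tail k, head k)) Set.univ (G.edgeSet \ tree.edgeSet)

open Classical in
/-- The change of the `ℤⁿ`-coordinate in a jump `i → j`: it is `± 1` in the `k`-th coordinate if
the `k`-th edge outside the tree is traversed, and `0` otherwise. -/
def TorusEmbedding.shift {G : SimpleGraph V} {n : ℕ} (T : TorusEmbedding G n) (i j : V) :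
    Fin n → ℤ := fun k =>
  if i = T.tail k ∧ j = T.head k then 1
  else if i = T.head k ∧ j = T.tail k then -1
  else 0

open Classical in
/-- The jump rates of the lifted chain on `V × ℤⁿ`: each edge `i - j` is lifted to the edges
between `(i, α)` and `(j, α + shift i j)`, with the same rates. -/
def TorusEmbedding.liftRate {Q : Matrix V V ℝ} {n : ℕ}
    (T : TorusEmbedding (transitionGraph Q) n) (x y : V × (Fin n → ℤ)) : ℝ :=
  if (transitionGraph Q).Adj x.1 y.1 ∧ y.2 = x.2 + T.shift x.1 y.1 then Q x.1 y.1 else 0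

end Finite

end LiftedChain

end

/-! The increments of a global potential along a jump of the lift depend only on the base edge
crossed. A potential exists because an antisymmetric edge function is a gradient on the spanning
tree, and the remaining defect at each non-tree edge is absorbed by a function linear in the
`ℤⁿ`-coordinate (`TorusEmbedding.exists_potential`). Detailed balance is the exponentiated increment
condition.

Energy: `dE/dt` is the mean of the backward generator applied to `φ`. This is a function of the base
state, so `dE/dt` is a linear functional of the base marginal. The marginal solves the master
equation of the finite chain and converges to `w` (`tendsto_stationary`, by a Poincaré inequality).
The limit of `dE/dt` is the value of the functional at `w`, which `entropyProduction_eq` identifies.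
Exchanging derivative and infinite sum rests on `le_exp_mul`: on a bounded time interval the last
distribution dominates all earlier ones up to a constant.

Entropy: by Gibbs' inequality `H(t)` is at most the mean of `-log (ν / N)` for any positive `ν` of
mass at most `N`. Take `ν` to be `p 0` smeared by `exp (-|α - β|₁ / τ)`. Then `ν ≥ p 0` controls the
mean at time `0` by `H(0) + log N`, the increments of `log ν` along jumps are at most `n / τ`, so
the mean grows by at most `Λ n t / τ`, and `N` is polynomial in `τ`. The choice `τ = t` gives the
logarithmic bound (`entropy_le`, `exists_log_bound`). Finally `F = E - H`, and the entropy is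
negligible against `t`. -/

namespace LiftedChain

/-! ### Flows with bounded rates and means of functions with bounded increments. -/

section General

variable {S : Type*} {r : S → S → ℝ} {Λ ℓ : ℝ} {f u : S → ℝ} {p : ℝ → S → ℝ}

/-- The rates are nonnegative and the total rate of leaving a state is at most `Λ`. -/
structure HasBoundedRates (r : S → S → ℝ) (Λ : ℝ) : Prop where
  nonneg : ∀ x y, 0 ≤ r x y
  summable : ∀ x, Summable (r x)
  tsum_le : ∀ x, ∑' y, r x y ≤ Λ

/-- The increments of `f` along possible jumps are at most `ℓ` in absolute value. -/
def IsJumpLipschitz (r : S → S → ℝ) (ℓ : ℝ) (f : S → ℝ) : Prop :=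
  ∀ x y, 0 < r x y → |f y - f x| ≤ ℓ

/-- The backward generator of the chain with rates `r`. -/
noncomputable def generator (r : S → S → ℝ) (f : S → ℝ) (x : S) : ℝ :=
  ∑' y, r x y * (f y - f x)

theorem IsJumpLipschitz.abs (hf : IsJumpLipschitz r ℓ f) :
    IsJumpLipschitz r ℓ (fun x => |f x|) :=
  fun x y h => (abs_abs_sub_abs_le (f y) (f x)).trans (hf x y h)

theorem IsJumpLipschitz.min_const (hf : IsJumpLipschitz r ℓ f) (N : ℝ) :
    IsJumpLipschitz r ℓ (fun x => min (f x) N) := by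
  intro x y h
  refine (abs_min_sub_min_le_max (f y) N (f x) N).trans ?_
  exact max_le (hf x y h) (by simpa using (abs_nonneg _).trans (hf x y h))

namespace HasBoundedRates

theorem le (hr : HasBoundedRates r Λ) (x y : S) : r x y ≤ Λ :=
  ((hr.summable x).le_tsum y fun z _ => hr.nonneg x z).trans (hr.tsum_le x)

theorem bound_nonneg (hr : HasBoundedRates r Λ) [Nonempty S] : 0 ≤ Λ :=
  (hr.nonneg (Classical.arbitrary S) (Classical.arbitrary S)).trans (hr.le _ _)

theorem tsum_nonneg (hr : HasBoundedRates r Λ) (x : S) : 0 ≤ ∑' y, r x y :=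
  _root_.tsum_nonneg fun y => hr.nonneg x y

theorem summable_inflow (hr : HasBoundedRates r Λ) (hu : ∀ x, 0 ≤ u x) (hs : Summable u) (x : S) :
    Summable fun y => u y * r y x :=
  Summable.of_nonneg_of_le (fun y => mul_nonneg (hu y) (hr.nonneg y x))
    (fun y => mul_le_mul_of_nonneg_left (hr.le y x) (hu y)) (hs.mul_right Λ)

theorem inflow_nonneg (hr : HasBoundedRates r Λ) (hu : ∀ x, 0 ≤ u x) (x : S) :
    0 ≤ ∑' y, u y * r y x :=
  _root_.tsum_nonneg fun y => mul_nonneg (hu y) (hr.nonneg y x)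

theorem tsum_forward (hr : HasBoundedRates r Λ) (hu : ∀ x, 0 ≤ u x) (hs : Summable u) (x : S) :
    ∑' y, (u y * r y x - u x * r x y) = ∑' y, u y * r y x - u x * ∑' y, r x y := by
  rw [(hr.summable_inflow hu hs x).tsum_sub ((hr.summable x).mul_left (u x)), tsum_mul_left]

theorem abs_generator_le (hr : HasBoundedRates r Λ) (hl : 0 ≤ ℓ) (hf : IsJumpLipschitz r ℓ f)
    (x : S) : |generator r f x| ≤ Λ * ℓ := by
  refine (tsum_of_norm_bounded (f := fun y => r x y * (f y - f x))
    ((hr.summable x).hasSum.mul_right ℓ) fun y => ?_).trans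
    (mul_le_mul_of_nonneg_right (hr.tsum_le x) hl)
  rw [Real.norm_eq_abs, abs_mul, abs_of_nonneg (hr.nonneg x y)]
  rcases (hr.nonneg x y).eq_or_lt with h | h
  · simp [← h]
  · exact mul_le_mul_of_nonneg_left (hf x y h) h.le

/-- Since a jump changes `|f|` by at most `ℓ`, the family is dominated by `u x * (|f x| + ℓ) * r x
y`, whose sum over `y` is at most `Λ * u x * (|f x| + ℓ)`. This absolute convergence on `S × S`
justifies every later exchange of sums. -/
theorem summable_flux (hr : HasBoundedRates r Λ) (hl : 0 ≤ ℓ) (hf : IsJumpLipschitz r ℓ f)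
    (hu : ∀ x, 0 ≤ u x) (hs : Summable u) (hsf : Summable fun x => u x * f x) :
    Summable fun z : S × S => u z.1 * r z.1 z.2 * f z.2 := by
  have hsf' : Summable fun x => u x * |f x| := by
    simpa only [abs_mul, abs_of_nonneg (hu _)] using hsf.abs
  have hG : Summable fun z : S × S => u z.1 * (|f z.1| + ℓ) * r z.1 z.2 := by
    have hv : ∀ x, 0 ≤ u x * (|f x| + ℓ) := fun x =>
      mul_nonneg (hu x) (add_nonneg (abs_nonneg _) hl)
    have hvs : Summable fun x => u x * (|f x| + ℓ) := by
      simpa only [mul_add] using hsf'.add (hs.mul_right ℓ)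
    have h0 : (0 : S × S → ℝ) ≤ fun z => u z.1 * (|f z.1| + ℓ) * r z.1 z.2 :=
      fun z => mul_nonneg (hv z.1) (hr.nonneg z.1 z.2)
    refine (summable_prod_of_nonneg h0).2
      ⟨fun x => (hr.summable x).mul_left (u x * (|f x| + ℓ)), ?_⟩
    simp only [tsum_mul_left]
    exact Summable.of_nonneg_of_le (fun x => mul_nonneg (hv x) (hr.tsum_nonneg x))
      (fun x => mul_le_mul_of_nonneg_left (hr.tsum_le x) (hv x)) (hvs.mul_right Λ)
  refine Summable.of_norm_bounded hG fun ⟨x, y⟩ => ?_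
  simp only [Real.norm_eq_abs, abs_mul, abs_of_nonneg (hu x), abs_of_nonneg (hr.nonneg x y)]
  rcases (hr.nonneg x y).eq_or_lt with h | h
  · simp [← h]
  · have h1 : |f y| ≤ |f x| + ℓ := by
      have := hf x y h
      have := abs_sub_abs_le_abs_sub (f y) (f x)
      linarith
    calc u x * r x y * |f y| ≤ u x * r x y * (|f x| + ℓ) :=
          mul_le_mul_of_nonneg_left h1 (mul_nonneg (hu x) h.le)
      _ = _ := by ring

theorem summable_inflow_mul (hr : HasBoundedRates r Λ) (hl : 0 ≤ ℓ) (hf : IsJumpLipschitz r ℓ f)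
    (hu : ∀ x, 0 ≤ u x) (hs : Summable u) (hsf : Summable fun x => u x * f x) :
    Summable fun x => (∑' y, u y * r y x) * f x := by
  have := ((Equiv.prodComm S S).summable_iff.2 (hr.summable_flux hl hf hu hs hsf)).prod
  simpa [Function.comp_def, tsum_mul_right] using this

theorem tsum_inflow_mul (hr : HasBoundedRates r Λ) (hl : 0 ≤ ℓ) (hf : IsJumpLipschitz r ℓ f)
    (hu : ∀ x, 0 ≤ u x) (hs : Summable u) (hsf : Summable fun x => u x * f x) :
    ∑' x, (∑' y, u y * r y x) * f x = ∑' x, ∑' y, u x * r x y * f y := by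
  have h := hr.summable_flux hl hf hu hs hsf
  have := h.tsum_comm (f := fun x y => u x * r x y * f y)
  rw [← this]
  simp only [tsum_mul_right]

theorem summable_outflow_mul (hr : HasBoundedRates r Λ)
    (hsf : Summable fun x => u x * f x) :
    Summable fun x => u x * (∑' y, r x y) * f x := by
  refine Summable.of_norm_bounded (hsf.abs.mul_right Λ) fun x => ?_
  rw [Real.norm_eq_abs, mul_right_comm, abs_mul, abs_of_nonneg (hr.tsum_nonneg x)]
  exact mul_le_mul_of_nonneg_left (hr.tsum_le x) (abs_nonneg _)

/-- Adjointness of the forward and backward generators: Fubini for the inflow, then subtraction of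
the outflow term by term. -/
theorem tsum_forward_mul (hr : HasBoundedRates r Λ) (hl : 0 ≤ ℓ) (hf : IsJumpLipschitz r ℓ f)
    (hu : ∀ x, 0 ≤ u x) (hs : Summable u) (hsf : Summable fun x => u x * f x) :
    ∑' x, (∑' y, (u y * r y x - u x * r x y)) * f x = ∑' x, u x * generator r f x := by
  have hin := hr.summable_inflow_mul hl hf hu hs hsf
  have hout := hr.summable_outflow_mul hsf
  simp only [hr.tsum_forward hu hs, sub_mul]
  rw [hin.tsum_sub hout, hr.tsum_inflow_mul hl hf hu hs hsf,
    ← (hr.summable_flux hl hf hu hs hsf).prod.tsum_sub hout]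
  refine tsum_congr fun x => ?_
  have h1 : Summable fun y => u x * r x y * f y :=
    (hr.summable_flux hl hf hu hs hsf).prod_factor x
  have h2 : Summable fun y => u x * r x y * f x :=
    ((hr.summable x).mul_left (u x)).mul_right (f x)
  have h3 : u x * (∑' y, r x y) * f x = ∑' y, u x * r x y * f x := by
    rw [tsum_mul_right, tsum_mul_left]
  rw [h3, ← h1.tsum_sub h2, generator, ← tsum_mul_left]
  exact tsum_congr fun y => by ring

end HasBoundedRates

namespace IsDistributionFlow

theorem summable (hp : IsDistributionFlow r p) {t : ℝ} (ht : 0 ≤ t) : Summable (p t) :=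
  (hp.hasSum_one t ht).summable

theorem le_one (hp : IsDistributionFlow r p) {t : ℝ} (ht : 0 ≤ t) (x : S) : p t x ≤ 1 :=
  le_hasSum (hp.hasSum_one t ht) x fun y _ => hp.nonneg t ht y

theorem nonempty (hp : IsDistributionFlow r p) : Nonempty S := by
  by_contra h
  rw [not_nonempty_iff] at h
  have := (hp.hasSum_one 0 le_rfl).tsum_eq
  simp at this

theorem continuousOn (hp : IsDistributionFlow r p) (x : S) :
    ContinuousOn (fun s => p s x) (Set.Ici 0) :=
  fun t ht => (hp.forward_equation t ht x).continuousWithinAt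

theorem hasDerivAt (hp : IsDistributionFlow r p) {t : ℝ} (ht : 0 < t) (x : S) :
    HasDerivAt (fun s => p s x) (∑' y, (p t y * r y x - p t x * r x y)) t :=
  (hp.forward_equation t ht.le x).hasDerivAt (Ici_mem_nhds ht)

/-- Mass leaves a state at rate at most `Λ`. -/
theorem le_exp_mul (hp : IsDistributionFlow r p) (hr : HasBoundedRates r Λ) {s t : ℝ}
    (hs : 0 ≤ s) (hst : s ≤ t) (x : S) : p s x ≤ Real.exp (Λ * (t - s)) * p t x := by
  -- The factor `exp (Λ s)` compensates the largest possible outflow, leaving a derivative bounded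
  -- below by the inflow.
  have hmono : MonotoneOn (fun s => Real.exp (Λ * s) * p s x) (Set.Ici 0) := by
    have hd : ∀ t, 0 < t → HasDerivAt (fun s => Real.exp (Λ * s) * p s x)
        (Real.exp (Λ * t) * (Λ * 1) * p t x +
          Real.exp (Λ * t) * (∑' y, (p t y * r y x - p t x * r x y))) t := fun t ht =>
      (((hasDerivAt_id t).const_mul Λ).exp).mul (hp.hasDerivAt ht x)
    refine monotoneOn_of_deriv_nonneg (convex_Ici 0)
      ((by fun_prop : Continuous fun s : ℝ => Real.exp (Λ * s)).continuousOn.mul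
        (hp.continuousOn x)) ?_ ?_
    · rw [interior_Ici]
      exact fun t ht => (hd t ht).differentiableAt.differentiableWithinAt
    · rw [interior_Ici]
      intro t ht
      have ht' : 0 ≤ t := (Set.mem_Ioi.1 ht).le
      rw [(hd t ht).deriv, hr.tsum_forward (hp.nonneg t ht') (hp.summable ht') x]
      have h1 := hr.inflow_nonneg (hp.nonneg t ht') x
      have h2 := mul_le_mul_of_nonneg_left (hr.tsum_le x) (hp.nonneg t ht' x)
      have h3 := Real.exp_pos (Λ * t)
      have : 0 ≤ Λ * p t x + (∑' y, p t y * r y x - p t x * ∑' y, r x y) := by linarith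
      calc (0 : ℝ) ≤ Real.exp (Λ * t) *
            (Λ * p t x + (∑' y, p t y * r y x - p t x * ∑' y, r x y)) := by positivity
        _ = _ := by ring
  have h := hmono (Set.mem_Ici.2 hs) (Set.mem_Ici.2 (hs.trans hst)) hst
  have h' : Real.exp (Λ * s) * p s x ≤ Real.exp (Λ * s) * (Real.exp (Λ * (t - s)) * p t x) := by
    rw [← mul_assoc, ← Real.exp_add, show Λ * s + Λ * (t - s) = Λ * t by ring]
    exact h
  exact le_of_mul_le_mul_left h' (Real.exp_pos _)

theorem le_exp_mul' (hp : IsDistributionFlow r p) (hr : HasBoundedRates r Λ) {s t : ℝ}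
    (hs : 0 ≤ s) (hst : s ≤ t) (x : S) : p s x ≤ Real.exp (Λ * t) * p t x := by
  have := hp.nonempty
  refine (hp.le_exp_mul hr hs hst x).trans (mul_le_mul_of_nonneg_right
    (Real.exp_le_exp.2 (mul_le_mul_of_nonneg_left (by linarith) hr.bound_nonneg))
    (hp.nonneg t (hs.trans hst) x))

/-- Summability at the right endpoint suffices: `p t`, multiplied by `exp (Λ t)`, dominates all
earlier distributions. -/
theorem continuousOn_tsum_mul (hp : IsDistributionFlow r p) (hr : HasBoundedRates r Λ)
    {t : ℝ} (ht : 0 ≤ t) (h : Summable fun x => p t x * f x) :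
    ContinuousOn (fun s => ∑' x, p s x * f x) (Set.Icc 0 t) := by
  refine continuousOn_tsum (u := fun x => Real.exp (Λ * t) * |p t x * f x|)
    (fun x => ((hp.continuousOn x).mono Set.Icc_subset_Ici_self).mul continuousOn_const)
    (h.abs.mul_left _) fun x s hs => ?_
  rw [Real.norm_eq_abs, abs_mul, abs_mul, abs_of_nonneg (hp.nonneg s hs.1 x),
    abs_of_nonneg (hp.nonneg t ht x), ← mul_assoc]
  exact mul_le_mul_of_nonneg_right (hp.le_exp_mul' hr hs.1 hs.2 x) (abs_nonneg _)

/-- Means of functions with bounded increments may be differentiated under the sum. -/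
theorem hasDerivAt_tsum_mul (hp : IsDistributionFlow r p) (hr : HasBoundedRates r Λ)
    (hl : 0 ≤ ℓ) (hf : IsJumpLipschitz r ℓ f)
    (h : ∀ t, 0 ≤ t → Summable fun x => p t x * f x) {t : ℝ} (ht : 0 < t) :
    HasDerivAt (fun s => ∑' x, p s x * f x) (∑' x, p t x * generator r f x) t := by
  have := hp.nonempty
  rw [← hr.tsum_forward_mul hl hf (hp.nonneg t ht.le) (hp.summable ht.le) (h t ht.le)]
  -- A time strictly after `t`: the distribution at `b` yields a summable bound for the derivatives
  -- on the open interval `(0, b)` around `t`.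
  set b := t + 1
  have hb : 0 ≤ b := by positivity
  have habs : Summable fun x => p b x * |f x| := by
    simpa only [abs_mul, abs_of_nonneg (hp.nonneg b hb _)] using (h b hb).abs
  have hin := hr.summable_inflow_mul hl hf.abs (hp.nonneg b hb) (hp.summable hb) habs
  refine hasDerivAt_tsum_of_isPreconnected
    (u := fun x => Real.exp (Λ * b) * ((∑' y, p b y * r y x) * |f x| + Λ * (p b x * |f x|)))
    (t := Set.Ioo 0 b) ((hin.add (habs.mul_left Λ)).mul_left _) isOpen_Ioo isPreconnected_Ioo
    (fun x s hs => (hp.hasDerivAt hs.1 x).mul_const (f x)) ?_ (y₀ := t) ⟨ht, by simp [b]⟩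
    (h t ht.le) ⟨ht, by simp [b]⟩
  intro x s hs
  have hs0 : 0 ≤ s := hs.1.le
  rw [Real.norm_eq_abs, abs_mul, hr.tsum_forward (hp.nonneg s hs0) (hp.summable hs0) x]
  have hin0 := hr.inflow_nonneg (hp.nonneg s hs0) x
  have hE := Real.exp_pos (Λ * b)
  have h1 : ∑' y, p s y * r y x ≤ Real.exp (Λ * b) * ∑' y, p b y * r y x := by
    rw [← tsum_mul_left]
    refine (hr.summable_inflow (hp.nonneg s hs0) (hp.summable hs0) x).tsum_le_tsum (fun y => ?_)
      ((hr.summable_inflow (hp.nonneg b hb) (hp.summable hb) x).mul_left _)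
    rw [← mul_assoc]
    exact mul_le_mul_of_nonneg_right (hp.le_exp_mul' hr hs0 hs.2.le y) (hr.nonneg y x)
  have h2 : p s x * ∑' y, r x y ≤ Real.exp (Λ * b) * p b x * Λ :=
    mul_le_mul (hp.le_exp_mul' hr hs0 hs.2.le x) (hr.tsum_le x) (hr.tsum_nonneg x)
      (mul_nonneg hE.le (hp.nonneg b hb x))
  have h3 : 0 ≤ p s x * ∑' y, r x y := mul_nonneg (hp.nonneg s hs0 x) (hr.tsum_nonneg x)
  have h4 : |∑' y, p s y * r y x - p s x * ∑' y, r x y| ≤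
      Real.exp (Λ * b) * ∑' y, p b y * r y x + Real.exp (Λ * b) * p b x * Λ := by
    rw [abs_le]; constructor <;> linarith
  calc _ ≤ _ := mul_le_mul_of_nonneg_right h4 (abs_nonneg (f x))
    _ = _ := by ring

theorem abs_tsum_mul_generator_le (hp : IsDistributionFlow r p) (hr : HasBoundedRates r Λ)
    (hl : 0 ≤ ℓ) (hf : IsJumpLipschitz r ℓ f) {t : ℝ} (ht : 0 ≤ t) :
    |∑' x, p t x * generator r f x| ≤ Λ * ℓ := by
  have := tsum_of_norm_bounded (f := fun x => p t x * generator r f x)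
    ((hp.hasSum_one t ht).mul_right (Λ * ℓ)) fun x => by
      rw [Real.norm_eq_abs, abs_mul, abs_of_nonneg (hp.nonneg t ht x)]
      exact mul_le_mul_of_nonneg_left (hr.abs_generator_le hl hf x) (hp.nonneg t ht x)
  simpa using this

theorem tsum_mul_le (hp : IsDistributionFlow r p) (hr : HasBoundedRates r Λ)
    (hl : 0 ≤ ℓ) (hf : IsJumpLipschitz r ℓ f)
    (h : ∀ t, 0 ≤ t → Summable fun x => p t x * f x) {t : ℝ} (ht : 0 ≤ t) :
    ∑' x, p t x * f x ≤ ∑' x, p 0 x * f x + Λ * ℓ * t := by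
  have := Convex.image_sub_le_mul_sub_of_deriv_le (convex_Icc 0 t)
    (hp.continuousOn_tsum_mul hr ht (h t ht)) (C := Λ * ℓ) ?_ ?_ 0 ⟨le_rfl, ht⟩ t ⟨ht, le_rfl⟩ ht
  · linarith
  · rw [interior_Icc]
    exact fun s hs =>
      (hp.hasDerivAt_tsum_mul hr hl hf h hs.1).differentiableAt.differentiableWithinAt
  · rw [interior_Icc]
    intro s hs
    rw [(hp.hasDerivAt_tsum_mul hr hl hf h hs.1).deriv]
    exact (le_abs_self _).trans (hp.abs_tsum_mul_generator_le hr hl hf hs.1.le)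

theorem summable_mul_of_bounded (hp : IsDistributionFlow r p) {B : ℝ} (hB : ∀ x, |f x| ≤ B)
    {t : ℝ} (ht : 0 ≤ t) : Summable fun x => p t x * f x := by
  refine Summable.of_norm_bounded ((hp.summable ht).mul_right B) fun x => ?_
  rw [Real.norm_eq_abs, abs_mul, abs_of_nonneg (hp.nonneg t ht x)]
  exact mul_le_mul_of_nonneg_left (hB x) (hp.nonneg t ht x)

/-- Finiteness of the mean of a function with bounded increments is preserved by the flow. -/
theorem summable_mul (hp : IsDistributionFlow r p) (hr : HasBoundedRates r Λ)
    (hl : 0 ≤ ℓ) (hf : IsJumpLipschitz r ℓ f) (h : Summable fun x => p 0 x * f x)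
    {t : ℝ} (ht : 0 ≤ t) : Summable fun x => p t x * f x := by
  have h0 : Summable fun x => p 0 x * |f x| := by
    simpa only [abs_mul, abs_of_nonneg (hp.nonneg 0 le_rfl _)] using h.abs
  suffices Summable fun x => p t x * |f x| by
    refine Summable.of_norm_bounded this fun x => ?_
    rw [Real.norm_eq_abs, abs_mul, abs_of_nonneg (hp.nonneg t ht x)]
  refine summable_of_sum_le (c := ∑' x, p 0 x * |f x| + Λ * ℓ * t)
    (fun x => mul_nonneg (hp.nonneg t ht x) (abs_nonneg _)) fun F => ?_
  -- Truncation at `N` makes all means finite, so the linear growth bound applies. This `N` leaves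
  -- the values of `|f|` on `F` unchanged, and the resulting bound depends neither on `N` nor on
  -- `F`.
  set N := ∑ x ∈ F, |f x|
  have hN : 0 ≤ N := Finset.sum_nonneg fun x _ => abs_nonneg _
  have hnn : ∀ x, 0 ≤ min |f x| N := fun x => le_min (abs_nonneg _) hN
  have hbd : ∀ s, 0 ≤ s → Summable fun x => p s x * min |f x| N := fun s hs =>
    hp.summable_mul_of_bounded (B := N)
      (fun x => by rw [abs_of_nonneg (hnn x)]; exact min_le_right _ _) hs
  calc ∑ x ∈ F, p t x * |f x| = ∑ x ∈ F, p t x * min |f x| N :=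
        Finset.sum_congr rfl fun x hx => by
          rw [min_eq_left (Finset.single_le_sum (fun y _ => abs_nonneg (f y)) hx)]
    _ ≤ ∑' x, p t x * min |f x| N :=
        (hbd t ht).sum_le_tsum F fun x _ => mul_nonneg (hp.nonneg t ht x) (hnn x)
    _ ≤ ∑' x, p 0 x * min |f x| N + Λ * ℓ * t :=
        hp.tsum_mul_le hr hl (hf.abs.min_const N) hbd ht
    _ ≤ _ := by
        gcongr ?_ + _
        exact (hbd 0 le_rfl).tsum_le_tsum (fun x =>
          mul_le_mul_of_nonneg_left (min_le_left _ _) (hp.nonneg 0 le_rfl x)) h0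

end IsDistributionFlow

end General

end LiftedChain

/-! ### Potentials on a tree. -/

/-- On a tree every antisymmetric edge function is a gradient. -/
theorem SimpleGraph.IsTree.exists_potential {V : Type*} {G : SimpleGraph V} (hG : G.IsTree)
    (c : V → V → ℝ) (hc : ∀ i j, c j i = -c i j) :
    ∃ ψ : V → ℝ, ∀ i j, G.Adj i j → ψ j - ψ i = c i j := by
  have := hG.connected.nonempty
  let o := Classical.arbitrary V
  choose P hP _ using fun v => hG.existsUnique_path o v
  have key : ∀ i j, ∀ h : G.Adj i j, P j = (P i).concat h →
      ((P j).darts.map fun d => c d.fst d.snd).sum -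
        ((P i).darts.map fun d => c d.fst d.snd).sum = c i j := by
    intro i j h e
    rw [e, SimpleGraph.Walk.darts_concat]
    simp
  -- The potential is the sum of `c` along the tree path from the root. For adjacent `i`, `j`, one
  -- of the two root paths extends the other by this edge.
  refine ⟨fun v => ((P v).darts.map fun d => c d.fst d.snd).sum, fun i j h => ?_⟩
  by_cases hi : i ∈ (P j).support
  · exact key i j h (hG.isAcyclic.path_concat (hP i) (hP j) h hi)
  · have hj := hG.isAcyclic.mem_support_of_ne_mem_support_of_adj_of_isPath (hP i) (hP j) h hi
    have := key j i h.symm (hG.isAcyclic.path_concat (hP j) (hP i) h.symm hj)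
    rw [hc j i, ← this]
    ring

/-! ### The lift: its potential, detailed balance, generator and base marginal. -/

namespace LiftedChain

section Lift

variable {V : Type*} {Q : Matrix V V ℝ}

namespace IsChain

variable [Fintype V]

theorem adj_iff (hQ : IsChain Q) {i j : V} :
    (transitionGraph Q).Adj i j ↔ i ≠ j ∧ 0 < Q i j := by
  rw [transitionGraph, SimpleGraph.fromRel_adj, hQ.pos_symm j i, or_self]

theorem eq_zero_of_not_adj (hQ : IsChain Q) {i j : V} (hij : i ≠ j)
    (h : ¬ (transitionGraph Q).Adj i j) : Q i j = 0 := by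
  rw [hQ.adj_iff] at h
  push Not at h
  exact le_antisymm (h hij) (hQ.nonneg_offDiag i j hij)

end IsChain

namespace TorusEmbedding

variable {n : ℕ}

section Shift

variable {G : SimpleGraph V} (T : TorusEmbedding G n)

theorem adj_tail_head (k : Fin n) : G.Adj (T.tail k) (T.head k) :=
  (T.bijOn.mapsTo (Set.mem_univ k)).1

theorem shift_symm (i j : V) : T.shift j i = -T.shift i j := by
  funext k
  have := (T.adj_tail_head k).ne
  simp only [shift, Pi.neg_apply]
  split_ifs <;> grind

theorem abs_shift_le (i j : V) (k : Fin n) : |T.shift i j k| ≤ 1 := by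
  simp only [shift]
  split_ifs <;> simp

theorem shift_eq_zero {i j : V} (h : T.tree.Adj i j) : T.shift i j = 0 := by
  funext k
  have hk := (T.bijOn.mapsTo (Set.mem_univ k)).2
  rw [SimpleGraph.mem_edgeSet] at hk
  simp only [shift, Pi.zero_apply]
  have := h.symm
  split_ifs <;> grind

theorem shift_tail_head (k : Fin n) : T.shift (T.tail k) (T.head k) = Pi.single k 1 := by
  funext l
  have hinj : ∀ l, s(T.tail l, T.head l) = s(T.tail k, T.head k) → l = k := fun l h =>
    T.bijOn.injOn (Set.mem_univ l) (Set.mem_univ k) h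
  have h := hinj l
  rw [Sym2.eq_iff] at h
  by_cases hl : l = k
  · subst hl; simp [shift]
  · rw [Pi.single_eq_of_ne hl]
    simp only [shift]
    split_ifs <;> grind

theorem exists_eq_of_not_adj_tree {i j : V} (h : G.Adj i j) (ht : ¬ T.tree.Adj i j) :
    ∃ k, (i = T.tail k ∧ j = T.head k) ∨ (i = T.head k ∧ j = T.tail k) := by
  obtain ⟨k, -, hk⟩ := T.bijOn.surjOn (show s(i, j) ∈ G.edgeSet \ T.tree.edgeSet from ⟨h, ht⟩)
  refine ⟨k, ?_⟩
  have := Sym2.eq_iff.1 hk.symm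
  exact this

/-- An antisymmetric edge function lifts to a gradient. -/
theorem exists_potential (c : V → V → ℝ) (hc : ∀ i j, c j i = -c i j) :
    ∃ φ : V × (Fin n → ℤ) → ℝ, ∀ x y, G.Adj x.1 y.1 → y.2 = x.2 + T.shift x.1 y.1 →
      φ y - φ x = c x.1 y.1 := by
  obtain ⟨ψ, hψ⟩ := T.isTree.exists_potential c hc
  -- The defect of the tree potential at the `k`-th non-tree edge. Crossing that edge changes the
  -- `k`-th coordinate by `± 1`, so the linear term contributes exactly this defect.
  let a : Fin n → ℝ := fun k => c (T.tail k) (T.head k) - (ψ (T.head k) - ψ (T.tail k))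
  refine ⟨fun x => ψ x.1 + ∑ k, x.2 k * a k, ?_⟩
  rintro ⟨i, α⟩ ⟨j, β⟩ h e
  obtain rfl : β = α + T.shift i j := e
  have hsub : (ψ j + ∑ k, ((α + T.shift i j) k : ℤ) * a k) - (ψ i + ∑ k, α k * a k) =
      ψ j - ψ i + ∑ k, (T.shift i j k : ℝ) * a k := by
    simp only [Pi.add_apply, Int.cast_add, add_mul, Finset.sum_add_distrib]
    ring
  simp only [hsub]
  have hedge : ∀ k, ∑ l, (T.shift (T.tail k) (T.head k) l : ℝ) * a l = a k := by
    intro k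
    rw [T.shift_tail_head, Finset.sum_eq_single k]
    · simp
    · intro l _ hl
      simp [Pi.single_eq_of_ne hl]
    · simp
  by_cases ht : T.tree.Adj i j
  · simp [T.shift_eq_zero ht, hψ i j ht]
  · obtain ⟨k, ⟨rfl, rfl⟩ | ⟨rfl, rfl⟩⟩ := T.exists_eq_of_not_adj_tree h ht
    · rw [hedge]
      simp [a]
    · rw [T.shift_symm]
      simp only [Pi.neg_apply, Int.cast_neg, neg_mul, Finset.sum_neg_distrib]
      rw [hedge, hc (T.tail k)]
      simp only [a]
      ring

end Shift

variable (T : TorusEmbedding (transitionGraph Q) n)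

/-- The state reached from `x` by a jump to `j` in the base. -/
noncomputable def next (x : V × (Fin n → ℤ)) (j : V) : V × (Fin n → ℤ) := (j, x.2 + T.shift x.1 j)

theorem next_injective (x : V × (Fin n → ℤ)) : Function.Injective (T.next x) :=
  fun _ _ h => congrArg Prod.fst h

theorem liftRate_swap_eq {x y : V × (Fin n → ℤ)} :
    ((transitionGraph Q).Adj x.1 y.1 ∧ y.2 = x.2 + T.shift x.1 y.1) ↔
      ((transitionGraph Q).Adj y.1 x.1 ∧ x.2 = y.2 + T.shift y.1 x.1) := by
  rw [T.shift_symm x.1 y.1, (transitionGraph Q).adj_comm]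
  refine and_congr_right fun _ => ?_
  constructor <;> intro h <;> rw [h] <;> abel

theorem liftRate_eq {x y : V × (Fin n → ℤ)} (h : 0 < T.liftRate x y) :
    T.liftRate x y = Q x.1 y.1 := by
  rw [liftRate] at h ⊢
  split_ifs at h ⊢ with h'
  · rfl
  · exact absurd h (lt_irrefl 0)

theorem log_div_swap (i j : V) : Real.log (Q i j / Q j i) = -Real.log (Q j i / Q i j) := by
  rw [← Real.log_inv, inv_div]

/-- The probability of a state of the base. -/
noncomputable def marginal (_T : TorusEmbedding (transitionGraph Q) n)
    (u : V × (Fin n → ℤ) → ℝ) (i : V) : ℝ :=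
  ∑' x : V × (Fin n → ℤ), u x * Set.indicator {i} 1 x.1

theorem summable_marginal {u : V × (Fin n → ℤ) → ℝ} (hu : Summable u) (i : V) :
    Summable fun x : V × (Fin n → ℤ) => u x * Set.indicator {i} (1 : V → ℝ) x.1 := by
  refine Summable.of_norm_bounded hu.abs fun x => ?_
  rw [Real.norm_eq_abs, abs_mul]
  refine mul_le_of_le_one_right (abs_nonneg _) ?_
  by_cases h : x.1 = i <;> simp [Set.indicator, h]

variable [Fintype V]

theorem liftRate_pos_iff (hQ : IsChain Q) {x y : V × (Fin n → ℤ)} :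
    0 < T.liftRate x y ↔ (transitionGraph Q).Adj x.1 y.1 ∧ y.2 = x.2 + T.shift x.1 y.1 := by
  rw [liftRate]
  split_ifs with h
  · exact iff_of_true (hQ.adj_iff.1 h.1).2 h
  · exact iff_of_false (lt_irrefl 0) h

theorem liftRate_nonneg (hQ : IsChain Q) (x y : V × (Fin n → ℤ)) : 0 ≤ T.liftRate x y := by
  rw [liftRate]
  split_ifs with h
  · exact (hQ.adj_iff.1 h.1).2.le
  · exact le_rfl

theorem liftRate_swap_pos (hQ : IsChain Q) {x y : V × (Fin n → ℤ)} :
    0 < T.liftRate x y ↔ 0 < T.liftRate y x := by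
  rw [T.liftRate_pos_iff hQ, T.liftRate_pos_iff hQ, T.liftRate_swap_eq]

theorem hasSum_liftRate_mul (x : V × (Fin n → ℤ)) (g : V × (Fin n → ℤ) → ℝ) :
    HasSum (fun y => T.liftRate x y * g y)
      (∑ j, T.liftRate x (T.next x j) * g (T.next x j)) := by
  refine ((T.next_injective x).hasSum_iff ?_).1 (hasSum_fintype _)
  intro y hy
  rw [liftRate, if_neg, zero_mul]
  exact fun h => hy ⟨y.1, Prod.ext rfl h.2.symm⟩

/-- The lift has no self-jumps, whereas the diagonal of `Q` carries minus the exit rates. The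
hypothesis on `a` removes the diagonal, as happens for increments of functions. -/
theorem liftRate_next_mul (hQ : IsChain Q) (x : V × (Fin n → ℤ)) (j : V) {a : ℝ}
    (ha : j = x.1 → a = 0) : T.liftRate x (T.next x j) * a = Q x.1 j * a := by
  rw [liftRate]
  split_ifs with h
  · rfl
  · by_cases hj : j = x.1
    · rw [ha hj, mul_zero, mul_zero]
    · rw [hQ.eq_zero_of_not_adj (Ne.symm hj) fun h' => h ⟨h', rfl⟩]

/-- A bound for the exit rates. -/
theorem hasBoundedRates (hQ : IsChain Q) :
    HasBoundedRates T.liftRate (∑ i, ∑ j, |Q i j|) where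
  nonneg := T.liftRate_nonneg hQ
  summable x := by simpa using (T.hasSum_liftRate_mul x fun _ => 1).summable
  tsum_le x := by
    have := (T.hasSum_liftRate_mul x fun _ => 1).tsum_eq
    simp only [mul_one] at this
    rw [this]
    calc ∑ j, T.liftRate x (T.next x j) ≤ ∑ j, |Q x.1 j| := Finset.sum_le_sum fun j _ => by
          rw [liftRate]
          split_ifs
          · exact le_abs_self _
          · exact abs_nonneg _
      _ ≤ _ := Finset.single_le_sum (f := fun i => ∑ j, |Q i j|)
          (fun i _ => Finset.sum_nonneg fun j _ => abs_nonneg _) (Finset.mem_univ x.1)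

/-- If the increments of `f` along jumps are `c`, its generator depends on the base only. -/
theorem generator_eq (hQ : IsChain Q) {f : V × (Fin n → ℤ) → ℝ} {c : V → V → ℝ}
    (hc : ∀ i, c i i = 0) (hf : ∀ x y, 0 < T.liftRate x y → f y - f x = c x.1 y.1)
    (x : V × (Fin n → ℤ)) : generator T.liftRate f x = ∑ j, Q x.1 j * c x.1 j := by
  rw [generator, (T.hasSum_liftRate_mul x fun y => f y - f x).tsum_eq]
  refine Finset.sum_congr rfl fun j _ => ?_
  rw [← T.liftRate_next_mul hQ x j (a := c x.1 j) fun h => h ▸ hc j]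
  rcases (T.liftRate_nonneg hQ x (T.next x j)).eq_or_lt with h | h
  · rw [← h, zero_mul, zero_mul]
  · rw [hf _ _ h]
    rfl

theorem isJumpLipschitz {f : V × (Fin n → ℤ) → ℝ} {c : V → V → ℝ}
    (hf : ∀ x y, 0 < T.liftRate x y → f y - f x = c x.1 y.1) :
    IsJumpLipschitz T.liftRate (∑ i, ∑ j, |c i j|) f := by
  intro x y h
  rw [hf x y h]
  exact (Finset.single_le_sum (f := fun j => |c x.1 j|) (fun j _ => abs_nonneg _)
    (Finset.mem_univ y.1)).trans (Finset.single_le_sum (f := fun i => ∑ j, |c i j|)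
      (fun i _ => Finset.sum_nonneg fun j _ => abs_nonneg _) (Finset.mem_univ x.1))

theorem exists_isGlobalPotential (hQ : IsChain Q) : ∃ φ, IsGlobalPotential T.liftRate φ := by
  obtain ⟨φ, hφ⟩ := T.exists_potential (fun i j => Real.log (Q j i / Q i j))
    fun i j => log_div_swap i j
  refine ⟨φ, fun x y h => ?_⟩
  have h' := (T.liftRate_pos_iff hQ).1 h
  rw [T.liftRate_eq h, T.liftRate_eq ((T.liftRate_swap_pos hQ).1 h)]
  exact hφ x y h'.1 h'.2

theorem potential_increment (hQ : IsChain Q) {φ : V × (Fin n → ℤ) → ℝ}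
    (hφ : IsGlobalPotential T.liftRate φ) (x y : V × (Fin n → ℤ)) (h : 0 < T.liftRate x y) :
    φ y - φ x = Real.log (Q y.1 x.1 / Q x.1 y.1) := by
  rw [hφ x y h, T.liftRate_eq h, T.liftRate_eq ((T.liftRate_swap_pos hQ).1 h)]

theorem isDetailedBalanced_gibbs (hQ : IsChain Q) {φ : V × (Fin n → ℤ) → ℝ}
    (hφ : IsGlobalPotential T.liftRate φ) : IsDetailedBalanced T.liftRate (gibbs φ) := by
  intro x y
  rcases (T.liftRate_nonneg hQ x y).eq_or_lt with h | h
  · have h' : T.liftRate y x = 0 := by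
      by_contra hne
      have := (T.liftRate_swap_pos hQ).1 ((T.liftRate_nonneg hQ y x).lt_of_ne (Ne.symm hne))
      exact this.ne h
    rw [← h, h', mul_zero, mul_zero]
  · have h' := (T.liftRate_swap_pos hQ).1 h
    have e : T.liftRate y x = Real.exp (φ y - φ x) * T.liftRate x y := by
      rw [hφ x y h, Real.exp_log (div_pos h' h), div_mul_cancel₀ _ h.ne']
    rw [e, gibbs, gibbs, ← mul_assoc, ← Real.exp_add]
    congr 2
    ring

theorem tsum_mul_fst {u : V × (Fin n → ℤ) → ℝ} (hu : Summable u) (h : V → ℝ) :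
    ∑' x, u x * h x.1 = ∑ i, T.marginal u i * h i := by
  simp only [marginal, ← tsum_mul_right]
  rw [← Summable.tsum_finsetSum fun i _ => (summable_marginal hu i).mul_right (h i)]
  refine tsum_congr fun x => ?_
  rw [Finset.sum_eq_single x.1]
  · simp
  · intro i _ hi
    simp [Set.indicator, Ne.symm hi]
  · simp

variable {p : ℝ → V × (Fin n → ℤ) → ℝ}

theorem sum_marginal (hp : IsDistributionFlow T.liftRate p) {t : ℝ} (ht : 0 ≤ t) :
    ∑ i, T.marginal (p t) i = 1 := by
  have := T.tsum_mul_fst (hp.summable ht) fun _ => 1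
  simpa [(hp.hasSum_one t ht).tsum_eq] using this.symm

/-- The base coordinate of the lifted chain is the original chain. -/
theorem hasDerivAt_marginal (hQ : IsChain Q) (hp : IsDistributionFlow T.liftRate p) {t : ℝ}
    (ht : 0 < t) (i : V) :
    HasDerivAt (fun s => T.marginal (p s) i) (∑ j, T.marginal (p t) j * Q j i) t := by
  let g : V → ℝ := Set.indicator {i} 1
  have hinc : ∀ x y, 0 < T.liftRate x y → g y.1 - g x.1 = g y.1 - g x.1 :=
    fun _ _ _ => rfl
  have hl : 0 ≤ ∑ i, ∑ j, |g j - g i| :=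
    Finset.sum_nonneg fun i _ => Finset.sum_nonneg fun j _ => abs_nonneg _
  have hlip := T.isJumpLipschitz (f := fun x => g x.1) (c := fun i j => g j - g i) hinc
  have hs : ∀ s, 0 ≤ s → Summable fun x : V × (Fin n → ℤ) => p s x * g x.1 :=
    fun s hs => summable_marginal (hp.summable hs) i
  have hd := hp.hasDerivAt_tsum_mul (T.hasBoundedRates hQ) hl hlip hs ht
  suffices key : ∑' x, p t x * generator T.liftRate (fun x => g x.1) x =
      ∑ j, T.marginal (p t) j * Q j i by
    rw [key] at hd
    exact hd
  rw [← T.tsum_mul_fst (hp.summable ht.le)]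
  refine tsum_congr fun x => ?_
  rw [T.generator_eq hQ (f := fun x => g x.1) (c := fun i j => g j - g i) (by simp) hinc]
  -- The rows of `Q` sum to zero, so the subtracted value `g x.1` drops out.
  simp only [mul_sub, Finset.sum_sub_distrib, ← Finset.sum_mul, hQ.row_sum, zero_mul, sub_zero]
  rw [Finset.sum_eq_single i]
  · simp [g]
  · intro j _ hj
    simp [g, hj]
  · simp

end TorusEmbedding

end Lift

end LiftedChain

/-! ### The finite chain: convergence to equilibrium and entropy production. -/

namespace LiftedChain

section FiniteChain

variable {V : Type*} [Fintype V] {Q : Matrix V V ℝ} {w : V → ℝ}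

/-- At a zero of `w` the stationarity equation is a vanishing sum of nonnegative terms, so `w`
vanishes at all neighbours and, by connectedness, everywhere. -/
theorem IsStationary.pos (hQ : IsChain Q) (hw : IsStationary Q w) (i : V) : 0 < w i := by
  by_contra hi
  have hi0 : w i = 0 := le_antisymm (not_lt.1 hi) (hw.nonneg i)
  have step : ∀ a b, (transitionGraph Q).Adj a b → w a = 0 → w b = 0 := by
    intro a b hab ha
    have hnn : ∀ j ∈ Finset.univ, 0 ≤ w j * Q j a := fun j _ => by
      by_cases h : j = a
      · rw [h, ha, zero_mul]
      · exact mul_nonneg (hw.nonneg j) (hQ.nonneg_offDiag j a h)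
    have h0 := (Finset.sum_eq_zero_iff_of_nonneg hnn).1 (hw.stationary a) b (Finset.mem_univ b)
    exact (mul_eq_zero.1 h0).resolve_right (hQ.adj_iff.1 hab.symm).2.ne'
  have all : ∀ j, w j = 0 := fun j => by
    obtain ⟨q⟩ := hQ.irreducible i j
    clear hi
    induction q with
    | nil => exact hi0
    | cons h _ ih => exact ih (step _ _ h hi0)
  have := hw.sum_eq_one
  simp [all] at this

/-- The Dirichlet form of the chain (twice). -/
def dirichlet (Q : Matrix V V ℝ) (w u : V → ℝ) : ℝ := ∑ i, ∑ j, w i * Q i j * (u i - u j) ^ 2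

theorem dirichlet_term_nonneg (hQ : IsChain Q) (hw : IsStationary Q w) (u : V → ℝ) (i j : V) :
    0 ≤ w i * Q i j * (u i - u j) ^ 2 := by
  by_cases h : i = j
  · simp [h]
  · exact mul_nonneg (mul_nonneg (hw.nonneg i) (hQ.nonneg_offDiag i j h)) (sq_nonneg _)

theorem dirichlet_term_le (hQ : IsChain Q) (hw : IsStationary Q w) (u : V → ℝ) (i j : V) :
    w i * Q i j * (u i - u j) ^ 2 ≤ dirichlet Q w u :=
  (Finset.single_le_sum (f := fun j => w i * Q i j * (u i - u j) ^ 2)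
    (fun j _ => dirichlet_term_nonneg hQ hw u i j) (Finset.mem_univ j)).trans
    (Finset.single_le_sum (f := fun i => ∑ j, w i * Q i j * (u i - u j) ^ 2)
      (fun i _ => Finset.sum_nonneg fun j _ => dirichlet_term_nonneg hQ hw u i j)
      (Finset.mem_univ i))

theorem dirichlet_nonneg (hQ : IsChain Q) (hw : IsStationary Q w) (u : V → ℝ) :
    0 ≤ dirichlet Q w u :=
  Finset.sum_nonneg fun i _ => Finset.sum_nonneg fun j _ => dirichlet_term_nonneg hQ hw u i j

/-- Induction along a walk from `i` to `j`, with `(a + b)² ≤ 2a² + 2b²`; each edge of the walk has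
positive weight in the Dirichlet form. -/
theorem exists_sq_sub_le_dirichlet (hQ : IsChain Q) (hw : IsStationary Q w) (i j : V) :
    ∃ K : ℝ, 0 ≤ K ∧ ∀ u : V → ℝ, (u i - u j) ^ 2 ≤ K * dirichlet Q w u := by
  obtain ⟨q⟩ := hQ.irreducible i j
  induction q with
  | nil => exact ⟨0, le_rfl, fun u => by simp⟩
  | @cons a b c h _ ih =>
    obtain ⟨K, hK, hKu⟩ := ih
    have hpos : 0 < w a * Q a b := mul_pos (hw.pos hQ a) (hQ.adj_iff.1 h).2
    refine ⟨2 * (w a * Q a b)⁻¹ + 2 * K, by positivity, fun u => ?_⟩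
    have h1 : (u a - u b) ^ 2 ≤ (w a * Q a b)⁻¹ * dirichlet Q w u := by
      rw [inv_mul_eq_div, le_div_iff₀' hpos]
      exact dirichlet_term_le hQ hw u a b
    nlinarith [hKu u, sq_nonneg ((u a - u b) - (u b - u c))]

/-- For mean-zero `u`, twice the variance is the `w ⊗ w`-average of `(u i - u j)²`, and each such
square is controlled by the Dirichlet form. -/
theorem exists_poincare (hQ : IsChain Q) (hw : IsStationary Q w) :
    ∃ c : ℝ, 0 < c ∧ ∀ u : V → ℝ, ∑ i, w i * u i = 0 →
      c * ∑ i, w i * u i ^ 2 ≤ dirichlet Q w u := by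
  choose K hK hKu using exists_sq_sub_le_dirichlet hQ hw
  set M := ∑ i, ∑ j, K i j
  have hM : 0 ≤ M := Finset.sum_nonneg fun i _ => Finset.sum_nonneg fun j _ => hK i j
  -- Adding `1` keeps the constant positive and finite even when `M = 0`.
  refine ⟨(M + 1)⁻¹, by positivity, fun u hu => ?_⟩
  have hle : ∀ i j, (u i - u j) ^ 2 ≤ M * dirichlet Q w u := fun i j =>
    (hKu i j u).trans (mul_le_mul_of_nonneg_right
      ((Finset.single_le_sum (f := fun j => K i j) (fun j _ => hK i j) (Finset.mem_univ j)).trans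
        (Finset.single_le_sum (f := fun i => ∑ j, K i j)
          (fun i _ => Finset.sum_nonneg fun j _ => hK i j) (Finset.mem_univ i)))
      (dirichlet_nonneg hQ hw u))
  have hvar : ∑ i, ∑ j, w i * w j * (u i - u j) ^ 2 = 2 * ∑ i, w i * u i ^ 2 := by
    have : ∀ i, ∑ j, w i * w j * (u i - u j) ^ 2 =
        w i * u i ^ 2 * ∑ j, w j - 2 * (w i * u i) * ∑ j, w j * u j +
          w i * ∑ j, w j * u j ^ 2 := fun i => by
      simp only [Finset.mul_sum, ← Finset.sum_sub_distrib, ← Finset.sum_add_distrib]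
      exact Finset.sum_congr rfl fun j _ => by ring
    simp only [this, hw.sum_eq_one, hu, mul_one, mul_zero, sub_zero, Finset.sum_add_distrib,
      ← Finset.sum_mul, one_mul]
    ring
  have hbd : ∑ i, ∑ j, w i * w j * (u i - u j) ^ 2 ≤ M * dirichlet Q w u := by
    calc _ ≤ ∑ i, ∑ j, w i * w j * (M * dirichlet Q w u) :=
          Finset.sum_le_sum fun i _ => Finset.sum_le_sum fun j _ =>
            mul_le_mul_of_nonneg_left (hle i j) (mul_nonneg (hw.nonneg i) (hw.nonneg j))
      _ = M * dirichlet Q w u := by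
          simp only [← Finset.sum_mul, ← Finset.mul_sum, hw.sum_eq_one, mul_one, one_mul]
  have h0 := dirichlet_nonneg hQ hw u
  have h1 : 0 ≤ ∑ i, w i * u i ^ 2 :=
    Finset.sum_nonneg fun i _ => mul_nonneg (hw.nonneg i) (sq_nonneg _)
  rw [inv_mul_eq_div, div_le_iff₀ (by positivity)]
  nlinarith

/-- On expanding the square, the `u i ^ 2` terms vanish by the row sums and the `u j ^ 2` terms by
stationarity. Reversibility of `w` is not needed. -/
theorem dirichlet_eq (hQ : IsChain Q) (hw : IsStationary Q w) (u : V → ℝ) :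
    dirichlet Q w u = -(2 * ∑ i, ∑ j, w i * Q i j * (u i * u j)) := by
  have h1 : ∑ i, ∑ j, w i * Q i j * u i ^ 2 = 0 :=
    Finset.sum_eq_zero fun i _ => by
      rw [← Finset.sum_mul, ← Finset.mul_sum, hQ.row_sum, mul_zero, zero_mul]
  have h2 : ∑ i, ∑ j, w i * Q i j * u j ^ 2 = 0 := by
    rw [Finset.sum_comm]
    exact Finset.sum_eq_zero fun j _ => by rw [← Finset.sum_mul, hw.stationary, zero_mul]
  have : dirichlet Q w u = ∑ i, ∑ j, w i * Q i j * u i ^ 2 + ∑ i, ∑ j, w i * Q i j * u j ^ 2 -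
      2 * ∑ i, ∑ j, w i * Q i j * (u i * u j) := by
    simp only [dirichlet, Finset.mul_sum, ← Finset.sum_sub_distrib, ← Finset.sum_add_distrib]
    exact Finset.sum_congr rfl fun i _ => Finset.sum_congr rfl fun j _ => by ring
  rw [this, h1, h2]
  ring

/-- Convergence to the stationary distribution. -/
theorem tendsto_stationary (hQ : IsChain Q) (hw : IsStationary Q w) {P : ℝ → V → ℝ}
    (hP : ∀ t, 0 < t → ∀ i, HasDerivAt (fun s => P s i) (∑ j, P t j * Q j i) t)
    (hsum : ∀ t, 0 < t → ∑ i, P t i = 1) (i : V) :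
    Tendsto (fun t => P t i) atTop (𝓝 (w i)) := by
  have hpos := fun i => hw.pos hQ i
  obtain ⟨c, hc, hpoin⟩ := exists_poincare hQ hw
  -- Relative deviation from equilibrium; `D` below is the `χ²`-distance, with derivative minus the
  -- Dirichlet form, hence exponentially decaying by the Poincaré inequality.
  let u : ℝ → V → ℝ := fun t i => (P t i - w i) / w i
  have hwu : ∀ t i, w i * u t i = P t i - w i := fun t i => mul_div_cancel₀ _ (hpos i).ne'
  let D : ℝ → ℝ := fun t => ∑ i, w i * u t i ^ 2
  have hD0 : ∀ t, 0 ≤ D t := fun t =>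
    Finset.sum_nonneg fun i _ => mul_nonneg (hw.nonneg i) (sq_nonneg _)
  have hu0 : ∀ t, 0 < t → ∑ i, w i * u t i = 0 := fun t ht => by
    simp only [hwu, Finset.sum_sub_distrib, hsum t ht, hw.sum_eq_one, sub_self]
  have hdu : ∀ t, 0 < t → ∀ i, HasDerivAt (fun s => u s i) ((∑ j, w j * u t j * Q j i) / w i) t := by
    intro t ht i
    have e : ∑ j, w j * u t j * Q j i = ∑ j, P t j * Q j i := by
      simp only [hwu, sub_mul, Finset.sum_sub_distrib, hw.stationary i, sub_zero]
    rw [e]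
    exact ((hP t ht i).sub_const (w i)).div_const (w i)
  have hdD : ∀ t, 0 < t → HasDerivAt D (-dirichlet Q w (u t)) t := by
    intro t ht
    have h1 : HasDerivAt D (∑ i, w i * (2 * u t i * ((∑ j, w j * u t j * Q j i) / w i))) t := by
      refine HasDerivAt.fun_sum fun i _ => ?_
      simpa using (((hdu t ht i).pow 2).const_mul (w i))
    convert h1 using 1
    rw [dirichlet_eq hQ hw, neg_neg, Finset.sum_comm, Finset.mul_sum]
    refine Finset.sum_congr rfl fun i _ => ?_
    have := (hpos i).ne'
    rw [show w i * (2 * u t i * ((∑ j, w j * u t j * Q j i) / w i)) =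
      2 * u t i * ∑ j, w j * u t j * Q j i by field_simp]
    rw [Finset.mul_sum, Finset.mul_sum]
    exact Finset.sum_congr rfl fun j _ => by ring
  -- The half-line starts at `1` because nothing is assumed about `P` at time `0`.
  have hanti : AntitoneOn (fun t => Real.exp (c * t) * D t) (Set.Ici 1) := by
    have hd : ∀ t, 0 < t → HasDerivAt (fun t => Real.exp (c * t) * D t)
        (Real.exp (c * t) * (c * 1) * D t + Real.exp (c * t) * (-dirichlet Q w (u t))) t :=
      fun t ht => (((hasDerivAt_id t).const_mul c).exp).mul (hdD t ht)
    refine antitoneOn_of_deriv_nonpos (convex_Ici 1)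
      (fun t ht => (hd t (zero_lt_one.trans_le ht)).continuousAt.continuousWithinAt) ?_ ?_
    · rw [interior_Ici]
      exact fun t ht => (hd t (zero_lt_one.trans ht)).differentiableAt.differentiableWithinAt
    · rw [interior_Ici]
      intro t ht
      have ht0 : 0 < t := zero_lt_one.trans ht
      rw [(hd t ht0).deriv]
      have := hpoin (u t) (hu0 t ht0)
      have h3 : 0 ≤ dirichlet Q w (u t) - c * D t := sub_nonneg.2 this
      have h4 := mul_nonneg (Real.exp_pos (c * t)).le h3
      linarith
  have hbound : ∀ t, 1 ≤ t → D t ≤ Real.exp c * D 1 * Real.exp (-(c * t)) := by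
    intro t ht
    have h1 : Real.exp (c * t) * D t ≤ Real.exp (c * 1) * D 1 :=
      hanti (Set.mem_Ici.2 le_rfl) (Set.mem_Ici.2 ht) ht
    rw [mul_one] at h1
    have h2 := mul_le_mul_of_nonneg_right h1 (Real.exp_pos (-(c * t))).le
    rwa [mul_right_comm, ← Real.exp_add, add_neg_cancel, Real.exp_zero, one_mul] at h2
  have hexp : Tendsto (fun t => Real.exp (-(c * t))) atTop (𝓝 0) :=
    Real.tendsto_exp_neg_atTop_nhds_zero.comp (tendsto_id.const_mul_atTop hc)
  have hD : Tendsto D atTop (𝓝 0) := by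
    refine tendsto_of_tendsto_of_tendsto_of_le_of_le' tendsto_const_nhds
      (by simpa using hexp.const_mul (Real.exp c * D 1)) (Eventually.of_forall hD0) ?_
    filter_upwards [eventually_ge_atTop 1] with t ht using hbound t ht
  have hsq : Tendsto (fun t => (P t i - w i) ^ 2) atTop (𝓝 0) := by
    refine tendsto_of_tendsto_of_tendsto_of_le_of_le tendsto_const_nhds
      (by simpa using hD.const_mul (w i)) (fun t => sq_nonneg _) fun t => ?_
    have h1 : w i * u t i ^ 2 ≤ D t :=
      Finset.single_le_sum (f := fun i => w i * u t i ^ 2)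
        (fun i _ => mul_nonneg (hw.nonneg i) (sq_nonneg _)) (Finset.mem_univ i)
    have h2 := mul_le_mul_of_nonneg_left h1 (hw.nonneg i)
    calc (P t i - w i) ^ 2 = w i * (w i * u t i ^ 2) := by rw [← hwu]; ring
      _ ≤ w i * D t := h2
  have habs : Tendsto (fun t => |P t i - w i|) atTop (𝓝 0) := by
    simpa [Real.sqrt_sq_eq_abs] using hsq.sqrt
  exact tendsto_sub_nhds_zero_iff.1 ((tendsto_zero_iff_abs_tendsto_zero _).2 habs)

/-- Antisymmetry of the logarithm merges the two halves of the sum. Splitting it, the `log (w i)`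
part vanishes by the row sums and the `log (w j)` part by stationarity, leaving only the ratio of
rates. -/
theorem entropyProduction_eq (hQ : IsChain Q) (hw : IsStationary Q w) :
    entropyProduction Q w = -∑ i, w i * ∑ j, Q i j * Real.log (Q j i / Q i j) := by
  have hpos := fun i => hw.pos hQ i
  let a : V → V → ℝ := fun i j => Real.log ((w i * Q i j) / (w j * Q j i))
  have ha : ∀ i j, a j i = -a i j := fun i j => by
    simp only [a]
    rw [← Real.log_inv, inv_div]
  have h1 : entropyProduction Q w = ∑ i, ∑ j, w i * Q i j * a i j := by
    have hswap : ∑ i, ∑ j, w j * Q j i * a i j = -∑ i, ∑ j, w i * Q i j * a i j := by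
      rw [Finset.sum_comm]
      simp only [← Finset.sum_neg_distrib]
      exact Finset.sum_congr rfl fun i _ => Finset.sum_congr rfl fun j _ => by rw [ha]; ring
    have : entropyProduction Q w =
        1 / 2 * (∑ i, ∑ j, w i * Q i j * a i j - ∑ i, ∑ j, w j * Q j i * a i j) := by
      simp only [entropyProduction, sub_mul, Finset.sum_sub_distrib, a]
    rw [this, hswap]
    ring
  have h2 : ∀ i j, w i * Q i j * a i j = w i * Q i j * Real.log (w i) -
      w i * Q i j * Real.log (w j) - w i * (Q i j * Real.log (Q j i / Q i j)) := by
    intro i j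
    by_cases hij : i = j
    · subst hij
      by_cases h : Q i i = 0
      · simp [h]
      · simp [a, div_self h]
    rcases (hQ.nonneg_offDiag i j hij).eq_or_lt with h | h
    · simp [← h]
    · have h' := (hQ.pos_symm i j).1 h
      simp only [a]
      rw [Real.log_div (mul_pos (hpos i) h).ne' (mul_pos (hpos j) h').ne',
        Real.log_mul (hpos i).ne' h.ne', Real.log_mul (hpos j).ne' h'.ne',
        Real.log_div h'.ne' h.ne']
      ring
  have h3 : ∑ i, ∑ j, w i * Q i j * Real.log (w i) = 0 :=
    Finset.sum_eq_zero fun i _ => by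
      rw [← Finset.sum_mul, ← Finset.mul_sum, hQ.row_sum, mul_zero, zero_mul]
  have h4 : ∑ i, ∑ j, w i * Q i j * Real.log (w j) = 0 := by
    rw [Finset.sum_comm]
    exact Finset.sum_eq_zero fun j _ => by rw [← Finset.sum_mul, hw.stationary, zero_mul]
  rw [h1]
  simp only [h2, Finset.sum_sub_distrib, h3, h4, Finset.mul_sum]
  ring

end FiniteChain

end LiftedChain

/-! ### Exponential smearing and the logarithmic entropy bound. -/

namespace LiftedChain

section Entropy

theorem hasSum_exp_neg_abs_div {τ : ℝ} (hτ : 0 < τ) :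
    HasSum (fun m : ℤ => Real.exp (-(|(m : ℝ)| / τ)))
      ((1 - Real.exp (-(1 / τ)))⁻¹ + Real.exp (-(1 / τ)) * (1 - Real.exp (-(1 / τ)))⁻¹) := by
  have h1 : Real.exp (-(1 / τ)) < 1 := by
    rw [Real.exp_lt_one_iff]
    have : 0 < 1 / τ := by positivity
    linarith
  have hg := hasSum_geometric_of_lt_one (Real.exp_pos (-(1 / τ))).le h1
  refine HasSum.of_nat_of_neg_add_one ?_ ?_
  · refine (congrArg (fun g : ℕ → ℝ => HasSum g _) (funext fun m => ?_)).mpr hg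
    rw [← Real.exp_nat_mul]
    congr 1
    rw [Int.cast_natCast, Nat.abs_cast]
    ring
  · refine (congrArg (fun g : ℕ → ℝ => HasSum g _) (funext fun m => ?_)).mpr
      (hg.mul_left (Real.exp (-(1 / τ))))
    rw [← Real.exp_nat_mul, ← Real.exp_add]
    congr 1
    push_cast
    rw [abs_neg, abs_of_nonneg (by positivity)]
    ring

/-- The full series is `(1 + q) / (1 - q)` with `q = exp (-1 / τ)`, and `exp (1 / τ) ≥ 1 + 1 / τ`
gives `1 - q ≥ 1 / (τ + 1)`. -/
theorem sum_exp_neg_abs_sub_div_le {τ : ℝ} (hτ : 0 < τ) (F : Finset ℤ) (b : ℤ) :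
    ∑ m ∈ F, Real.exp (-(|(m : ℝ) - b| / τ)) ≤ 2 * (τ + 1) := by
  have hb := (Equiv.subRight b).hasSum_iff.2 (hasSum_exp_neg_abs_div hτ)
  simp only [Function.comp_def, Equiv.subRight_apply, Int.cast_sub] at hb
  refine (sum_le_hasSum F (fun m _ => (Real.exp_pos _).le) hb).trans ?_
  set q := Real.exp (-(1 / τ))
  have hq : q ≤ τ / (τ + 1) := by
    have h1 : 1 / τ + 1 ≤ Real.exp (1 / τ) := Real.add_one_le_exp _
    have h2 : q = (Real.exp (1 / τ))⁻¹ := Real.exp_neg _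
    rw [h2, inv_le_comm₀ (Real.exp_pos _) (by positivity), inv_div]
    calc (τ + 1) / τ = 1 / τ + 1 := by field_simp; ring
      _ ≤ _ := h1
  have hq' : (τ + 1)⁻¹ ≤ 1 - q := by
    have : τ / (τ + 1) + (τ + 1)⁻¹ = 1 := by field_simp
    linarith
  have hinv : (1 - q)⁻¹ ≤ τ + 1 := inv_le_of_inv_le₀ (by positivity) hq'
  have hq1 : q ≤ 1 := by
    have : (0 : ℝ) < (τ + 1)⁻¹ := by positivity
    linarith
  have h0 : 0 ≤ (1 - q)⁻¹ := inv_nonneg.2 (by linarith)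
  nlinarith

variable {V : Type*} {n : ℕ}

/-- The kernel `exp (-|α - β|₁ / τ)`. -/
noncomputable def expKernel (τ : ℝ) (α β : Fin n → ℤ) : ℝ :=
  ∏ k, Real.exp (-(|(α k : ℝ) - β k| / τ))

theorem expKernel_pos (τ : ℝ) (α β : Fin n → ℤ) : 0 < expKernel τ α β :=
  Finset.prod_pos fun _ _ => Real.exp_pos _

theorem expKernel_self (τ : ℝ) (α : Fin n → ℤ) : expKernel τ α α = 1 := by
  simp [expKernel]

theorem expKernel_le_one {τ : ℝ} (hτ : 0 < τ) (α β : Fin n → ℤ) : expKernel τ α β ≤ 1 :=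
  Finset.prod_le_one (fun _ _ => (Real.exp_pos _).le) fun k _ => by
    rw [Real.exp_le_one_iff]
    have : 0 ≤ |(α k : ℝ) - β k| / τ := by positivity
    linarith

theorem exp_mul_expKernel_le {τ : ℝ} (hτ : 0 < τ) {α α' : Fin n → ℤ} (h : ∀ k, |α' k - α k| ≤ 1)
    (β : Fin n → ℤ) : Real.exp (-(n / τ)) * expKernel τ α β ≤ expKernel τ α' β := by
  have hn : Real.exp (-(n / τ)) = ∏ _k : Fin n, Real.exp (-(1 / τ)) := by
    rw [Finset.prod_const, Finset.card_univ, Fintype.card_fin, ← Real.exp_nat_mul]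
    congr 1
    ring
  rw [hn, expKernel, ← Finset.prod_mul_distrib]
  refine Finset.prod_le_prod (fun k _ => by positivity) fun k _ => ?_
  rw [← Real.exp_add, Real.exp_le_exp]
  have h1 : |(α' k : ℝ) - α k| ≤ 1 := by exact_mod_cast h k
  have h2 : |(α' k : ℝ) - β k| ≤ 1 + |(α k : ℝ) - β k| :=
    (abs_sub_le _ (α k : ℝ) _).trans (by linarith)
  have h3 := div_le_div_of_nonneg_right h2 hτ.le
  rw [add_div] at h3
  linarith

theorem sum_expKernel_le [Fintype V] {τ : ℝ} (hτ : 0 < τ) (F : Finset (V × (Fin n → ℤ)))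
    (β : Fin n → ℤ) :
    ∑ y ∈ F, expKernel τ y.2 β ≤ Fintype.card V * (2 * (τ + 1)) ^ n := by
  classical
  -- A box containing the `ℤⁿ`-projection of `F`; over a box the sum of products factorises into
  -- one-dimensional sums.
  let B : Finset (Fin n → ℤ) := Fintype.piFinset fun k => F.image fun y => y.2 k
  have hF : F ⊆ Finset.univ ×ˢ B := fun y hy => by
    simp only [Finset.mem_product, Finset.mem_univ, true_and, B, Fintype.mem_piFinset]
    exact fun k => Finset.mem_image_of_mem (fun y : V × (Fin n → ℤ) => y.2 k) hy
  calc ∑ y ∈ F, expKernel τ y.2 β ≤ ∑ y ∈ Finset.univ ×ˢ B, expKernel τ y.2 β :=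
        Finset.sum_le_sum_of_subset_of_nonneg hF fun y _ _ => (expKernel_pos τ _ _).le
    _ = Fintype.card V * ∑ α ∈ B, expKernel τ α β := by
        simp [Finset.sum_product]
    _ ≤ _ := by
        refine mul_le_mul_of_nonneg_left ?_ (Nat.cast_nonneg _)
        simp only [expKernel, B]
        rw [← Finset.prod_univ_sum (fun k : Fin n => F.image fun y => y.2 k)
          (fun k (m : ℤ) => Real.exp (-(|(m : ℝ) - β k| / τ)))]
        calc _ ≤ ∏ _k : Fin n, 2 * (τ + 1) :=
              Finset.prod_le_prod (fun k _ => Finset.sum_nonneg fun _ _ => (Real.exp_pos _).le)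
                fun k _ => sum_exp_neg_abs_sub_div_le hτ _ _
          _ = _ := by simp

/-- A distribution smeared out with the exponential kernel of scale `τ`. -/
noncomputable def smear (τ : ℝ) (u : V × (Fin n → ℤ) → ℝ) (y : V × (Fin n → ℤ)) : ℝ :=
  ∑' x : V × (Fin n → ℤ), u x * expKernel τ y.2 x.2

section Smear

variable {τ : ℝ} {u : V × (Fin n → ℤ) → ℝ}

theorem summable_mul_expKernel (hτ : 0 < τ) (hu : ∀ x, 0 ≤ u x) (h1 : HasSum u 1)
    (α : Fin n → ℤ) : Summable fun x : V × (Fin n → ℤ) => u x * expKernel τ α x.2 :=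
  Summable.of_nonneg_of_le (fun x => mul_nonneg (hu x) (expKernel_pos _ _ _).le)
    (fun x => mul_le_of_le_one_right (hu x) (expKernel_le_one hτ _ _)) h1.summable

theorem le_smear (hτ : 0 < τ) (hu : ∀ x, 0 ≤ u x) (h1 : HasSum u 1) (x : V × (Fin n → ℤ)) :
    u x ≤ smear τ u x := by
  have := (summable_mul_expKernel hτ hu h1 x.2).le_tsum x
    fun z _ => mul_nonneg (hu z) (expKernel_pos _ _ _).le
  rwa [expKernel_self, mul_one] at this

theorem smear_pos (hτ : 0 < τ) (hu : ∀ x, 0 ≤ u x) (h1 : HasSum u 1) (y : V × (Fin n → ℤ)) :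
    0 < smear τ u y := by
  obtain ⟨x, hx⟩ : ∃ x, u x ≠ 0 := by
    by_contra! h
    have : u = 0 := funext h
    rw [this] at h1
    exact zero_ne_one (hasSum_zero.unique h1)
  exact (summable_mul_expKernel hτ hu h1 y.2).tsum_pos
    (fun z => mul_nonneg (hu z) (expKernel_pos _ _ _).le) x
    (mul_pos ((hu x).lt_of_ne hx.symm) (expKernel_pos _ _ _))

theorem smear_le_one (hτ : 0 < τ) (hu : ∀ x, 0 ≤ u x) (h1 : HasSum u 1)
    (y : V × (Fin n → ℤ)) : smear τ u y ≤ 1 := by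
  rw [← h1.tsum_eq]
  exact (summable_mul_expKernel hτ hu h1 y.2).tsum_le_tsum
    (fun x => mul_le_of_le_one_right (hu x) (expKernel_le_one hτ _ _)) h1.summable

theorem exp_mul_smear_le (hτ : 0 < τ) (hu : ∀ x, 0 ≤ u x) (h1 : HasSum u 1)
    {y z : V × (Fin n → ℤ)} (h : ∀ k, |z.2 k - y.2 k| ≤ 1) :
    Real.exp (-(n / τ)) * smear τ u y ≤ smear τ u z := by
  rw [smear, ← tsum_mul_left]
  refine ((summable_mul_expKernel hτ hu h1 y.2).mul_left _).tsum_le_tsum (fun x => ?_)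
    (summable_mul_expKernel hτ hu h1 z.2)
  have := mul_le_mul_of_nonneg_left (exp_mul_expKernel_le hτ h x.2) (hu x)
  linarith

/-- This slow variation is the purpose of the smearing: a larger `τ` makes `log (smear τ u)` drift
more slowly along jumps, at the price of a larger total mass. -/
theorem log_smear_sub_le (hτ : 0 < τ) (hu : ∀ x, 0 ≤ u x) (h1 : HasSum u 1)
    {y z : V × (Fin n → ℤ)} (h : ∀ k, |z.2 k - y.2 k| ≤ 1) :
    Real.log (smear τ u y) - Real.log (smear τ u z) ≤ n / τ := by
  have hy := smear_pos hτ hu h1 y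
  have := Real.log_le_log (mul_pos (Real.exp_pos _) hy) (exp_mul_smear_le hτ hu h1 h)
  rw [Real.log_mul (Real.exp_pos _).ne' hy.ne', Real.log_exp] at this
  linarith

theorem sum_smear_le [Fintype V] (hτ : 0 < τ) (hu : ∀ x, 0 ≤ u x) (h1 : HasSum u 1)
    (F : Finset (V × (Fin n → ℤ))) :
    ∑ y ∈ F, smear τ u y ≤ Fintype.card V * (2 * (τ + 1)) ^ n := by
  have hx : ∀ y ∈ F, Summable fun x : V × (Fin n → ℤ) => u x * expKernel τ y.2 x.2 :=
    fun y _ => summable_mul_expKernel hτ hu h1 y.2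
  simp only [smear]
  rw [← Summable.tsum_finsetSum hx]
  simp only [← Finset.mul_sum]
  have hN : ∀ x : V × (Fin n → ℤ), ∑ y ∈ F, expKernel τ y.2 x.2 ≤
      Fintype.card V * (2 * (τ + 1)) ^ n := fun x => sum_expKernel_le hτ F x.2
  generalize (Fintype.card V : ℝ) * (2 * (τ + 1)) ^ n = N at hN ⊢
  have hle : ∀ x, u x * ∑ y ∈ F, expKernel τ y.2 x.2 ≤ u x * N := fun x =>
    mul_le_mul_of_nonneg_left (hN x) (hu x)
  have hs : Summable fun x => u x * N := h1.summable.mul_right N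
  have h0 : ∀ x, 0 ≤ u x * ∑ y ∈ F, expKernel τ y.2 x.2 := fun x =>
    mul_nonneg (hu x) (Finset.sum_nonneg fun y _ => (expKernel_pos τ y.2 x.2).le)
  have hs' : Summable fun x => u x * ∑ y ∈ F, expKernel τ y.2 x.2 :=
    Summable.of_nonneg_of_le h0 hle hs
  refine (hs'.tsum_le_tsum hle hs).trans ?_
  rw [tsum_mul_right, h1.tsum_eq, one_mul]

end Smear

/-- The pointwise form of Gibbs' inequality. -/
theorem neg_mul_log_le {a b : ℝ} (ha : 0 ≤ a) (hb : 0 < b) :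
    -(a * Real.log a) ≤ -(a * Real.log b) + (b - a) := by
  rcases ha.eq_or_lt with rfl | ha
  · simpa using hb.le
  · have h := Real.log_le_sub_one_of_pos (div_pos hb ha)
    rw [Real.log_div hb.ne' ha.ne'] at h
    have h2 := mul_le_mul_of_nonneg_left h ha.le
    have h3 : a * (b / a - 1) = b - a := by field_simp
    rw [h3] at h2
    linarith

theorem IsDistributionFlow.neg_mul_log_nonneg {S : Type*} {r : S → S → ℝ} {p : ℝ → S → ℝ}
    (hp : IsDistributionFlow r p) {t : ℝ} (ht : 0 ≤ t) (x : S) :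
    0 ≤ -(p t x * Real.log (p t x)) :=
  neg_nonneg.2 (mul_nonpos_of_nonneg_of_nonpos (hp.nonneg t ht x)
    (Real.log_nonpos (hp.nonneg t ht x) (hp.le_one ht x)))

/-- The entropy of a flow with steps of bounded size, in terms of a scale `τ`. -/
theorem IsDistributionFlow.entropy_le [Fintype V] {Λ τ : ℝ}
    {r : V × (Fin n → ℤ) → V × (Fin n → ℤ) → ℝ} {p : ℝ → V × (Fin n → ℤ) → ℝ}
    (hp : IsDistributionFlow r p) (hr : HasBoundedRates r Λ)
    (hstep : ∀ x y, 0 < r x y → ∀ k, |y.2 k - x.2 k| ≤ 1) (h0 : HasFiniteEntropy (p 0))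
    (hτ : 0 < τ) {t : ℝ} (ht : 0 ≤ t) :
    HasFiniteEntropy (p t) ∧ entropy (p t) ≤
      entropy (p 0) + Real.log (Fintype.card V * (2 * (τ + 1)) ^ n) + Λ * (n / τ) * t := by
  have hu := hp.nonneg 0 le_rfl
  have h1 := hp.hasSum_one 0 le_rfl
  set N : ℝ := Fintype.card V * (2 * (τ + 1)) ^ n
  let ν := smear τ (p 0)
  have hνpos : ∀ y, 0 < ν y := smear_pos hτ hu h1
  have hνsum : Summable ν := summable_of_sum_le (fun y => (hνpos y).le) (sum_smear_le hτ hu h1)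
  have hνle : ∑' y, ν y ≤ N := hνsum.tsum_le_of_sum_le (sum_smear_le hτ hu h1)
  obtain ⟨o⟩ := hp.nonempty
  have hNpos : 0 < N := by
    have : Nonempty V := ⟨o.1⟩
    have : 0 < Fintype.card V := Fintype.card_pos
    positivity
  -- `f = -log (ν / N)`, where `ν / N` has mass at most `1` and stays fixed in time. Gibbs'
  -- inequality bounds the entropy of `p t` by the mean of `f`.
  let f : V × (Fin n → ℤ) → ℝ := fun y => Real.log N - Real.log (ν y)
  have hf : IsJumpLipschitz r (n / τ) f := by
    intro x y hxy
    have ha := log_smear_sub_le hτ hu h1 (hstep x y hxy)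
    have hb := log_smear_sub_le hτ hu h1 (y := y) (z := x)
      (fun k => by rw [abs_sub_comm]; exact hstep x y hxy k)
    simp only [f, ν]
    rw [abs_le]
    constructor <;> linarith
  have hl : 0 ≤ n / τ := by positivity
  have hlogν : ∀ y, Real.log (ν y) ≤ 0 := fun y =>
    Real.log_nonpos (hνpos y).le (smear_le_one hτ hu h1 y)
  -- The kernel equals `1` on the diagonal, so `ν ≥ p 0` pointwise.
  have hle0 : ∀ x, p 0 x * -Real.log (ν x) ≤ -(p 0 x * Real.log (p 0 x)) := by
    intro x
    rcases (hu x).eq_or_lt with h | h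
    · simp [← h]
    · have := mul_le_mul_of_nonneg_left (Real.log_le_log h (le_smear hτ hu h1 x)) h.le
      simp only [ν]
      linarith
  have hsν : Summable fun x => p 0 x * -Real.log (ν x) :=
    Summable.of_nonneg_of_le (fun x => mul_nonneg (hu x) (neg_nonneg.2 (hlogν x))) hle0 h0
  have hfeq : (fun x => p 0 x * f x) = fun x => p 0 x * Real.log N + p 0 x * -Real.log (ν x) := by
    funext x
    simp only [f]
    ring
  have hs0 : Summable fun x => p 0 x * f x := by
    rw [hfeq]
    exact (h1.summable.mul_right _).add hsν
  have hE0 : ∑' x, p 0 x * f x ≤ entropy (p 0) + Real.log N := by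
    rw [hfeq, (h1.summable.mul_right _).tsum_add hsν, (h1.mul_right _).tsum_eq, one_mul,
      add_comm]
    exact add_le_add_left (hsν.tsum_le_tsum hle0 h0) _
  have hs : ∀ s, 0 ≤ s → Summable fun x => p s x * f x := fun s hs =>
    hp.summable_mul hr hl hf hs0 hs
  have hgibbs : ∀ x, -(p t x * Real.log (p t x)) ≤ p t x * f x + (ν x / N - p t x) := by
    intro x
    have := neg_mul_log_le (hp.nonneg t ht x) (div_pos (hνpos x) hNpos)
    rw [Real.log_div (hνpos x).ne' hNpos.ne'] at this
    simp only [f]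
    linarith
  have hsr : Summable fun x => p t x * f x + (ν x / N - p t x) :=
    (hs t ht).add ((hνsum.div_const N).sub (hp.summable ht))
  have hfin : HasFiniteEntropy (p t) :=
    Summable.of_nonneg_of_le (hp.neg_mul_log_nonneg ht) hgibbs hsr
  refine ⟨hfin, ?_⟩
  have hmass : ∑' x, (ν x / N - p t x) ≤ 0 := by
    rw [(hνsum.div_const N).tsum_sub (hp.summable ht), tsum_div_const,
      (hp.hasSum_one t ht).tsum_eq, sub_nonpos, div_le_one hNpos]
    exact hνle
  calc entropy (p t) ≤ ∑' x, (p t x * f x + (ν x / N - p t x)) := hfin.tsum_le_tsum hgibbs hsr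
    _ = ∑' x, p t x * f x + ∑' x, (ν x / N - p t x) :=
        (hs t ht).tsum_add ((hνsum.div_const N).sub (hp.summable ht))
    _ ≤ ∑' x, p t x * f x := by linarith
    _ ≤ ∑' x, p 0 x * f x + Λ * (n / τ) * t := hp.tsum_mul_le hr hl hf hs ht
    _ ≤ _ := by linarith

/-- With scale `τ = t` the drift term is the constant `Λ n`, and the mass is polynomial in `t`.
Constants are absorbed into `log t` since `log t ≥ log 2 > 0`. -/
theorem exists_log_bound [Fintype V] [Nonempty V] (n : ℕ) (Λ : ℝ) :
    ∃ C : ℝ, ∀ t : ℝ, 2 ≤ t →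
      Real.log (Fintype.card V * (2 * (t + 1)) ^ n) + Λ * (n / t) * t ≤ C * Real.log t := by
  refine ⟨|Real.log (Fintype.card V) + Λ * n| / Real.log 2 + n * 3, fun t ht => ?_⟩
  have hcard : (0 : ℝ) < Fintype.card V := by exact_mod_cast Fintype.card_pos
  have ht0 : 0 < t := by linarith
  have hlog2 : 0 < Real.log 2 := Real.log_pos (by norm_num)
  have hlog : Real.log 2 ≤ Real.log t := Real.log_le_log (by norm_num) ht
  -- For `t ≥ 2` one has `2 (t + 1) ≤ t³`.
  have h1 : Real.log (2 * (t + 1)) ≤ 3 * Real.log t := by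
    have : Real.log (t ^ 3) = 3 * Real.log t := by
      rw [Real.log_pow]
      norm_num
    rw [← this]
    refine Real.log_le_log (by positivity) ?_
    nlinarith [mul_nonneg (sub_nonneg.2 ht) (sub_nonneg.2 ht), mul_pos ht0 ht0]
  have h2 : Λ * (n / t) * t = Λ * n := by field_simp
  rw [Real.log_mul hcard.ne' (by positivity), Real.log_pow, h2]
  have h3 : |Real.log (Fintype.card V) + Λ * n| ≤
      |Real.log (Fintype.card V) + Λ * n| / Real.log 2 * Real.log t := by
    rw [div_mul_eq_mul_div, le_div_iff₀ hlog2]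
    exact mul_le_mul_of_nonneg_left hlog (abs_nonneg _)
  have h4 := le_abs_self (Real.log (Fintype.card V) + Λ * n)
  have h5 := mul_le_mul_of_nonneg_left h1 (Nat.cast_nonneg (α := ℝ) n)
  linarith

end Entropy

end LiftedChain

/-! ### Long-time rates of energy, entropy and free energy. -/

namespace LiftedChain

/-- A function whose derivative converges grows linearly. -/
theorem tendsto_div_of_tendsto_deriv {F : ℝ → ℝ} {a : ℝ}
    (hF : ∀ t, 0 < t → DifferentiableAt ℝ F t) (h : Tendsto (deriv F) atTop (𝓝 a)) :
    Tendsto (fun t => F t / t) atTop (𝓝 a) := by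
  rw [Metric.tendsto_atTop] at h ⊢
  intro ε hε
  obtain ⟨M, hM⟩ := h (ε / 2) (by positivity)
  set b := max M 1
  have hb : 0 < b := zero_lt_one.trans_le (le_max_right _ _)
  have hK : ∀ t, b ≤ t → |F t - a * t - (F b - a * b)| ≤ ε / 2 * (t - b) := by
    intro t ht
    have := Convex.norm_image_sub_le_of_norm_deriv_le (f := fun s => F s - a * s) (C := ε / 2)
      (s := Set.Ici b) (x := b) (y := t)
      (fun s hs => (hF s (hb.trans_le hs)).sub (by fun_prop)) (fun s hs => ?_) (convex_Ici b)
      (Set.mem_Ici.2 le_rfl) ht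
    · rwa [Real.norm_eq_abs, Real.norm_eq_abs, abs_of_nonneg (sub_nonneg.2 ht)] at this
    · have hd : HasDerivAt (fun s => F s - a * s) (deriv F s - a * 1) s :=
        (hF s (hb.trans_le hs)).hasDerivAt.sub ((hasDerivAt_id s).const_mul a)
      rw [hd.deriv, mul_one, ← dist_eq_norm]
      exact (hM s ((le_max_left _ _).trans hs)).le
  -- Beyond this time the constant `|F b - a * b|` is less than `ε t / 2`; the mean value inequality
  -- accounts for the other half of `ε t`.
  refine ⟨max b (2 * (|F b - a * b| + 1) / ε), fun t ht => ?_⟩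
  have htb : b ≤ t := (le_max_left _ _).trans ht
  have ht0 : 0 < t := hb.trans_le htb
  have hte : 2 * (|F b - a * b| + 1) ≤ t * ε := (div_le_iff₀ hε).1 ((le_max_right _ _).trans ht)
  have h1 := hK t htb
  have h2 : |F t - a * t| ≤ |F t - a * t - (F b - a * b)| + |F b - a * b| := by
    have := abs_add_le (F t - a * t - (F b - a * b)) (F b - a * b)
    rwa [sub_add_cancel] at this
  rw [Real.dist_eq, show F t / t - a = (F t - a * t) / t by field_simp, abs_div, abs_of_pos ht0,
    div_lt_iff₀ ht0]
  nlinarith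

section Lift

variable {V : Type*} [Fintype V] {Q : Matrix V V ℝ} {w : V → ℝ} {n : ℕ}
  (T : TorusEmbedding (transitionGraph Q) n) {φ : V × (Fin n → ℤ) → ℝ}
  {p : ℝ → V × (Fin n → ℤ) → ℝ}

/-- The generator applied to `φ` at `x` is `∑ j, Q i j * c i j` with `i = x.1`, so `dE/dt` sees only
the base marginal and inherits its convergence. -/
theorem finiteEnergy_and_dissipation (hQ : IsChain Q) (hw : IsStationary Q w)
    (hφ : IsGlobalPotential T.liftRate φ) (hp : IsDistributionFlow T.liftRate p)
    (hE : HasFiniteEnergy φ (p 0)) :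
    (∀ t, 0 ≤ t → HasFiniteEnergy φ (p t)) ∧
      (∀ t, 0 < t → DifferentiableAt ℝ (fun s => meanEnergy φ (p s)) t) ∧
      Tendsto (deriv fun s => meanEnergy φ (p s)) atTop (𝓝 (-entropyProduction Q w)) := by
  let c : V → V → ℝ := fun i j => Real.log (Q j i / Q i j)
  have hr := T.hasBoundedRates hQ
  have hinc : ∀ x y, 0 < T.liftRate x y → φ y - φ x = c x.1 y.1 := T.potential_increment hQ hφ
  have hc : ∀ i, c i i = 0 := fun i => by simp [c]
  have hlip := T.isJumpLipschitz hinc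
  have hl : 0 ≤ ∑ i, ∑ j, |c i j| :=
    Finset.sum_nonneg fun i _ => Finset.sum_nonneg fun j _ => abs_nonneg _
  have hfin : ∀ t, 0 ≤ t → Summable fun x => p t x * φ x := fun t ht =>
    hp.summable_mul hr hl hlip hE ht
  have hd : ∀ t, 0 < t → HasDerivAt (fun s => meanEnergy φ (p s))
      (∑ i, T.marginal (p t) i * ∑ j, Q i j * c i j) t := by
    intro t ht
    have := hp.hasDerivAt_tsum_mul hr hl hlip hfin ht
    rw [← T.tsum_mul_fst (hp.summable ht.le)]
    simp only [T.generator_eq hQ hc hinc] at this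
    exact this
  refine ⟨hfin, fun t ht => (hd t ht).differentiableAt, ?_⟩
  have hlim : Tendsto (fun t => ∑ i, T.marginal (p t) i * ∑ j, Q i j * c i j) atTop
      (𝓝 (-entropyProduction Q w)) := by
    rw [entropyProduction_eq hQ hw, neg_neg]
    exact tendsto_finsetSum _ fun i _ => (tendsto_stationary hQ hw
      (fun t ht i => T.hasDerivAt_marginal hQ hp ht i)
      (fun t ht => T.sum_marginal hp ht.le) i).mul_const _
  refine hlim.congr' ?_
  filter_upwards [eventually_gt_atTop 0] with t ht using (hd t ht).deriv.symm

theorem exists_entropy_bound (hQ : IsChain Q) :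
    ∃ C : ℝ, ∀ p, IsDistributionFlow T.liftRate p → HasFiniteEntropy (p 0) →
      (∀ t, 0 ≤ t → HasFiniteEntropy (p t)) ∧
      (∀ t, 2 ≤ t → entropy (p t) ≤ entropy (p 0) + C * Real.log t) ∧
      Tendsto (fun t => entropy (p t) / t) atTop (𝓝 0) := by
  have hV : Nonempty V := hQ.irreducible.nonempty
  have hr := T.hasBoundedRates hQ
  have hstep : ∀ x y, 0 < T.liftRate x y → ∀ k, |y.2 k - x.2 k| ≤ 1 := by
    intro x y h k
    rw [((T.liftRate_pos_iff hQ).1 h).2, Pi.add_apply, add_sub_cancel_left]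
    exact T.abs_shift_le _ _ k
  obtain ⟨C, hC⟩ := exists_log_bound (V := V) n (∑ i, ∑ j, |Q i j|)
  refine ⟨C, fun p hp h0 => ?_⟩
  have hbound : ∀ t, 2 ≤ t → entropy (p t) ≤ entropy (p 0) + C * Real.log t := fun t ht => by
    -- The scale is `τ = t`, a different comparison measure for each time.
    have h := (hp.entropy_le hr hstep h0 (by linarith : 0 < t) (by linarith : 0 ≤ t)).2
    have := hC t ht
    linarith
  -- For mere finiteness any scale will do; here `τ = 1`.
  refine ⟨fun t ht => (hp.entropy_le hr hstep h0 one_pos ht).1, hbound, ?_⟩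
  have hup : Tendsto (fun t => entropy (p 0) / t + C * (Real.log t / t)) atTop (𝓝 0) := by
    have h1 : Tendsto (fun t => entropy (p 0) / t) atTop (𝓝 0) :=
      tendsto_const_nhds.div_atTop tendsto_id
    have h2 : Tendsto (fun t => Real.log t / t) atTop (𝓝 0) := by
      simpa using Real.isLittleO_log_id_atTop.tendsto_div_nhds_zero
    simpa using h1.add (h2.const_mul C)
  refine tendsto_of_tendsto_of_tendsto_of_le_of_le' tendsto_const_nhds hup ?_ ?_
  · filter_upwards [eventually_ge_atTop 0] with t ht
    exact div_nonneg (tsum_nonneg (hp.neg_mul_log_nonneg ht)) ht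
  · filter_upwards [eventually_ge_atTop 2] with t ht
    have ht0 : 0 < t := by linarith
    rw [← mul_div_assoc, ← add_div]
    exact div_le_div_of_nonneg_right (hbound t ht) ht0.le

end Lift

theorem hasSum_freeEnergy {S : Type*} {φ u : S → ℝ} (hE : HasFiniteEnergy φ u)
    (hH : HasFiniteEntropy u) :
    HasSum (fun x => u x * Real.log (u x / gibbs φ x)) (meanEnergy φ u - entropy u) := by
  refine (congrArg (fun g : S → ℝ => HasSum g _) (funext fun x => ?_)).mpr
    (hE.hasSum.sub hH.hasSum)
  by_cases h : u x = 0
  · simp [h]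
  · rw [gibbs, Real.log_div h (Real.exp_pos _).ne', Real.log_exp]
    ring

end LiftedChain

theorem mainTheorem6 {V : Type*} [Fintype V] (Q : Matrix V V ℝ) (hQ : LiftedChain.IsChain Q)
    (w : V → ℝ) (hw : LiftedChain.IsStationary Q w)
    {n : ℕ} (T : LiftedChain.TorusEmbedding (LiftedChain.transitionGraph Q) n) :
    -- the lifted chain has a global potential
    (∃ φ, LiftedChain.IsGlobalPotential T.liftRate φ) ∧
    -- its Gibbs measure is detailed balanced
    (∀ φ, LiftedChain.IsGlobalPotential T.liftRate φ →
      LiftedChain.IsDetailedBalanced T.liftRate (LiftedChain.gibbs φ)) ∧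
    -- the mean potential energy and its dissipation
    (∀ φ, LiftedChain.IsGlobalPotential T.liftRate φ →
      ∀ p, LiftedChain.IsDistributionFlow T.liftRate p → LiftedChain.HasFiniteEnergy φ (p 0) →
        (∀ t, 0 ≤ t → LiftedChain.HasFiniteEnergy φ (p t)) ∧
        (∀ t, 0 < t → DifferentiableAt ℝ (fun s => LiftedChain.meanEnergy φ (p s)) t) ∧
        Tendsto (deriv fun s => LiftedChain.meanEnergy φ (p s)) atTop
          (𝓝 (-LiftedChain.entropyProduction Q w))) ∧
    -- the entropy is sublinear, with a logarithmic bound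
    (∃ C : ℝ, ∀ p, LiftedChain.IsDistributionFlow T.liftRate p →
      LiftedChain.HasFiniteEntropy (p 0) →
        (∀ t, 0 ≤ t → LiftedChain.HasFiniteEntropy (p t)) ∧
        (∀ t, 2 ≤ t →
          LiftedChain.entropy (p t) ≤ LiftedChain.entropy (p 0) + C * Real.log t) ∧
        Tendsto (fun t => LiftedChain.entropy (p t) / t) atTop (𝓝 0)) ∧
    -- hence the free energy is dissipated, in the mean, as potential energy
    (∀ φ, LiftedChain.IsGlobalPotential T.liftRate φ →
      ∀ p, LiftedChain.IsDistributionFlow T.liftRate p → LiftedChain.HasFiniteEnergy φ (p 0) →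
        LiftedChain.HasFiniteEntropy (p 0) →
        (∀ t, 0 ≤ t →
          Summable (fun x => p t x * Real.log (p t x / LiftedChain.gibbs φ x)) ∧
          LiftedChain.freeEnergy (LiftedChain.gibbs φ) (p t) =
            LiftedChain.meanEnergy φ (p t) - LiftedChain.entropy (p t)) ∧
        Tendsto (fun t => LiftedChain.meanEnergy φ (p t) / t) atTop
          (𝓝 (-LiftedChain.entropyProduction Q w)) ∧
        Tendsto (fun t => LiftedChain.freeEnergy (LiftedChain.gibbs φ) (p t) / t) atTop
          (𝓝 (-LiftedChain.entropyProduction Q w))) := by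
  refine ⟨T.exists_isGlobalPotential hQ, fun φ hφ => T.isDetailedBalanced_gibbs hQ hφ,
    fun φ hφ p hp hE => LiftedChain.finiteEnergy_and_dissipation T hQ hw hφ hp hE,
    LiftedChain.exists_entropy_bound T hQ, fun φ hφ p hp hE hH => ?_⟩
  obtain ⟨hfin, hdiff, hlim⟩ := LiftedChain.finiteEnergy_and_dissipation T hQ hw hφ hp hE
  obtain ⟨C, hC⟩ := LiftedChain.exists_entropy_bound T hQ
  obtain ⟨hent, -, hsub⟩ := hC p hp hH
  have hfree := fun t (ht : 0 ≤ t) => LiftedChain.hasSum_freeEnergy (hfin t ht) (hent t ht)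
  have hEt := LiftedChain.tendsto_div_of_tendsto_deriv hdiff hlim
  refine ⟨fun t ht => ⟨(hfree t ht).summable, (hfree t ht).tsum_eq⟩, hEt, ?_⟩
  have h := hEt.sub hsub
  rw [sub_zero] at h
  refine h.congr' ?_
  filter_upwards [eventually_ge_atTop 0] with t ht
  rw [LiftedChain.freeEnergy, (hfree t ht).tsum_eq, sub_div]
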